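/- Notation. For $N\in\mathbb N$ write $[N]=\{1,\dots,N\}$, $\mathbb T=\mathbb R/\mathbb Z$ (with Haar probability measure), and $e(\beta)=e^{2\pi i\beta}$. For $f:[N]\to\mathbb C$ put $\|f\|_1=\sum_{x\in[N]}|f(x)|$ and $\hat f(\alpha)=\sum_{x\in[N]}f(x)e(\alpha x)$ for $\alpha\in\mathbb T$. A function $\nu:[N]\to[0,\infty)$ has *Fourier decay of level $\theta$* if $$\sup_{\alpha\in\mathbb T}\left|\frac{\hat\nu(\alpha)}{\|\nu\|_1}-\frac{\hat 1_{[N]}(\alpha)}{\|1_{[N]}\|_1}\right|\le\theta$$ (where the first quotient is read as $0$ if $\nu$ vanishes identically), and it satisfies a *$p$-restriction estimate with constant $K$* if $$\int_{\mathbb T}|\hat\phi(\alpha)|^p\,\mathrm d\alpha\le K\,\|\nu\|_1^p\,N^{-1}\qquad\text{for every }\phi:[N]\to\mathbb C\text{ with }|\phi|\le\nu .$$ Proposition (Pseudorandom FGR). Let $c_1,\dots,c_s\in\mathbb Z\setminus\{0\}$ with $\sum_{i\in I}c_i=0$ for some non-empty $I\subset\{1,\dots,s\}$. For any $r,K\in\mathbb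 N$ there exist $N_0,M\in\mathbb N$ with $M\ge 1$ and a real $c_0>0$ (depending only on $c_1,\dots,c_s$, $r$ and $K$) such that for every $N\ge N_0$ the following holds. Let $\nu:[N]\to[0,\infty)$ satisfy an $(s-0.005)$-restriction estimate with constant $K$ and have Fourier decay of level $1/M$. Then for any functions $f_1,\dots,f_r:[N]\to[0,\infty)$ with $\nu=f_1+\dots+f_r$ we have $$\sum_{i=1}^r\ \sum_{\substack{\mathbf x\in[N]^s\\ c_1x_1+\dots+c_sx_s=0}} f_i(x_1)\cdots f_i(x_s)\ \ge\ c_0\,\|\nu\|_1^s\,N^{-1}.$$ -/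

import Mathlib

open MeasureTheory

/-! A function on the interval `[N] = {1, …, N}` is represented by a function on `ℤ` of which only
the values on `[N]` are ever used: every sum and every pointwise condition below runs over `[N]`. -/

namespace PseudorandomRado

/-- The interval `[N] = {1, 2, …, N}`, as a finite set of integers. -/
noncomputable def interval (N : ℕ) : Finset ℤ := Finset.Icc 1 (N : ℤ)

/-- The norm `‖f‖₁ = ∑ |f(x)|` of a function `f` on `[N]`. -/
noncomputable def l1Norm (N : ℕ) (f : ℤ → ℝ) : ℝ := ∑ x ∈ interval N, |f x|

/-- The Fourier transform `f̂(α) = ∑ f(x) e(α x)`, for `α ∈ 𝕋 = ℝ/ℤ`, of a function `f : [N] → ℂ`.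
Here `fourier x α = e(α x) = exp(2 π i α x)`. -/
noncomputable def fourierTransform (N : ℕ) (f : ℤ → ℂ) (α : UnitAddCircle) : ℂ :=
  ∑ x ∈ interval N, f x * fourier x α

/-- The indicator function `1_{[N]}`. -/
noncomputable def intervalIndicator (N : ℕ) : ℤ → ℝ :=
  Set.indicator (interval N : Set ℤ) (fun _ => 1)

/-- `ν : [N] → [0, ∞)` has Fourier decay of level `θ` (with respect to `1_{[N]}`):
the sup norm of `ν̂ / ‖ν‖₁ - 1̂_{[N]} / ‖1_{[N]}‖₁` over the torus is at most `θ`. -/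
def HasFourierDecay (N : ℕ) (ν : ℤ → ℝ) (θ : ℝ) : Prop :=
  ∀ α : UnitAddCircle,
    ‖fourierTransform N (fun x => (ν x : ℂ)) α / (l1Norm N ν : ℂ)
      - fourierTransform N (fun x => (intervalIndicator N x : ℂ)) α
          / (l1Norm N (intervalIndicator N) : ℂ)‖ ≤ θ

/-- `ν : [N] → [0, ∞)` satisfies a `p`-restriction estimate with constant `K`: for every
`φ : [N] → ℂ` with `|φ| ≤ ν`, the integral of `|φ̂|^p` over the torus (with respect to Haar
probability measure) is at most `K ‖ν‖₁^p N⁻¹`. -/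
def SatisfiesRestriction (N : ℕ) (ν : ℤ → ℝ) (p K : ℝ) : Prop :=
  ∀ φ : ℤ → ℂ, (∀ x ∈ interval N, ‖φ x‖ ≤ ν x) →
    ∫ α : UnitAddCircle, ‖fourierTransform N φ α‖ ^ p ≤ K * l1Norm N ν ^ p * (N : ℝ)⁻¹

/-- The set of `x ∈ [N]^s` with `c₁ x₁ + ⋯ + c_s x_s = 0`. -/
noncomputable def solutions {s : ℕ} (c : Fin s → ℤ) (N : ℕ) : Finset (Fin s → ℤ) :=
  (Fintype.piFinset fun _ => interval N).filter fun x => ∑ j, c j * x j = 0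

end PseudorandomRado

/-! The proof combines a counting form of Rado's theorem with a Fourier-analytic transference
argument.

Counting: colour linear forms (vectors in `ι → ℕ`) instead of integers. Gallai's theorem and
induction on the number of colours give a monochromatic solution in forms, all but one of them
linearly independent (`exists_mono_genericSolution`). Each point `t` of a box of side `n` pulls a
colouring of the integers back to forms, hence yields a monochromatic integer solution. By
independence each solution arises from few `t` (`IsGenericSolution.card_fiber_le`), so there are at
least a constant times `n ^ (s - 1)` of them (`card_mono_solutions_ge`).

Transference: scale `ν` to have mean value 1 on `[N]` and replace each colour function by its
average over translates by `A - A`, where `A` is a dense set whose differences nearly annihilate the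
large spectra of all the colour functions. This multiplies Fourier transforms by a weight in `[0,
1]` that is near 1 on those spectra. Since the restriction exponent is below `s`, the number of
solutions hardly changes (`abs_sum_solutions_sub_le`). Fourier decay of `ν` makes the averaged
functions sum to at least `1/2` pointwise (`abs_averageDiff_le`). Colouring each point by a large
summand reduces the claim to the counting theorem; no upper bound on the averages is needed. -/

namespace PseudorandomRado

/-! ### Gallai's theorem -/

/-- A finitary form of Gallai's theorem: every finite colouring of the vectors with natural
coordinates has a monochromatic homothetic copy of the box `[0, L]^ι`, with bounded dilation and
translation. -/
theorem exists_bounded_mono_homothetic_box (ι : Type) [Fintype ι] (r L : ℕ) :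
    ∃ m : ℕ, ∀ χ : (ι → ℕ) → Fin r, ∃ (a : ℕ) (b : ι → ℕ) (e : Fin r), 0 < a ∧ a ≤ m ∧
      (∀ y, b y ≤ m) ∧ ∀ x : ι → ℕ, (∀ y, x y ≤ L) → χ (fun y => b y + a * x y) = e := by
  classical
  obtain ⟨J, _, hJ⟩ := Combinatorics.Line.exists_mono_in_high_dimension (ι → Fin (L + 1)) (Fin r)
  refine ⟨Fintype.card J * (L + 1), fun χ => ?_⟩
  -- A word is coloured through the sum of its letters. Along a combinatorial line the active
  -- coordinates `A` contribute `A.card` times the running letter, and the fixed ones contribute the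
  -- translation `b`.
  obtain ⟨l, e, hl⟩ := hJ fun f => χ fun y => ∑ j, (f j y : ℕ)
  set A : Finset J := {j | l.idxFun j = none} with hA
  set b : ι → ℕ := fun y => ∑ j ∈ Aᶜ, ((l 0 j y : Fin (L + 1)) : ℕ) with hb
  refine ⟨A.card, b, e, Finset.card_pos.mpr ?_, ?_, fun y => ?_, fun x hx => ?_⟩
  · obtain ⟨j, hj⟩ := l.proper
    exact ⟨j, by simp [hA, hj]⟩
  · exact (Finset.card_le_univ A).trans (Nat.le_mul_of_pos_right _ (Nat.succ_pos L))
  · calc b y ≤ ∑ j ∈ Aᶜ, (L + 1) := Finset.sum_le_sum fun j _ => (l 0 j y).isLt.le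
      _ = Aᶜ.card * (L + 1) := by simp
      _ ≤ _ := Nat.mul_le_mul_right _ (Finset.card_le_univ _)
  · rw [← hl fun y => ⟨x y, Nat.lt_succ_of_le (hx y)⟩]
    congr 1
    ext y
    rw [← Finset.sum_add_sum_compl A, add_comm]
    congr 1
    · rw [← smul_eq_mul, ← Finset.sum_const]
      refine Finset.sum_congr rfl fun j hj => ?_
      rw [l.apply_none _ _ (by simpa [hA] using hj)]
    · refine Finset.sum_congr rfl fun j hj => ?_
      have hj' : l.idxFun j ≠ none := by simpa [hA] using hj
      obtain ⟨z, hz⟩ := Option.ne_none_iff_exists.mp hj'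
      simp [← hz]

/-! ### Generic solutions in linear forms and the block construction -/

/-- A solution of `∑ c_j x_j = 0` in non-zero vectors with coordinates in `[0, H]` (thought of as
linear forms), which is generic: the vectors `S j`, `j ≠ i₀`, are linearly independent. -/
structure IsGenericSolution {s : ℕ} (c : Fin s → ℤ) (i₀ : Fin s) {ι : Type} (H : ℕ)
    (S : Fin s → ι → ℕ) : Prop where
  ne_zero : ∀ j, S j ≠ 0
  le : ∀ j y, S j y ≤ H
  sum_eq_zero : ∀ y, ∑ j, c j * (S j y : ℤ) = 0
  indep : ∀ q : Fin s → ℤ, q i₀ = 0 → (∀ y, ∑ j, q j * (S j y : ℤ) = 0) → q = 0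

section Blocks

variable {s : ℕ} {ι : Type}

/-- The vector on `Fin s × ι` which agrees with `d` on the block `k` and vanishes elsewhere. -/
def blockEmbed (k : Fin s) (d : ι → ℕ) : Fin s × ι → ℕ := fun y => if y.1 = k then d y.2 else 0

/-- The solution built from a box `b + a [0, 2R]^(Fin s × ι)` and vectors supported on the
blocks. -/
def blockSolution (c : Fin s → ℤ) (I : Finset (Fin s)) (i₀ : Fin s) (a R : ℕ)
    (b : Fin s × ι → ℕ) (d : Fin s → ι → ℕ) (k : Fin s) (y : Fin s × ι) : ℕ :=
  if k = i₀ then b y + a * (R + (if y.1 = i₀ then 0 else -(c i₀ * c y.1 * d y.1 y.2))).toNat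
  else if k ∈ I then b y + a * (R + (c i₀).natAbs ^ 2 * blockEmbed k (d k) y)
  else a * ((c i₀).natAbs ^ 2 * blockEmbed k (d k) y)

/-- In the colour induction, this carries a solution found with fewer colours back to the larger
vector space. -/
theorem IsGenericSolution.blockEmbed {c : Fin s → ℤ} {i₀ : Fin s} {H H' u : ℕ} (k : Fin s)
    {S : Fin s → ι → ℕ} (hS : IsGenericSolution c i₀ H S) (hu : 0 < u) (hH : u * H ≤ H') :
    IsGenericSolution c i₀ H' (fun j y => u * PseudorandomRado.blockEmbed k (S j) y) where
  ne_zero j h := by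
    refine hS.ne_zero j (funext fun x => ?_)
    have := congrFun h (k, x)
    simpa [PseudorandomRado.blockEmbed, hu.ne'] using this
  le j y := by
    refine le_trans (Nat.mul_le_mul_left u ?_) hH
    unfold PseudorandomRado.blockEmbed
    split_ifs
    · exact hS.le j _
    · exact Nat.zero_le _
  sum_eq_zero y := by
    have h := hS.sum_eq_zero y.2
    unfold PseudorandomRado.blockEmbed
    split_ifs
    · have : ∑ j, c j * ((u * S j y.2 : ℕ) : ℤ) = u * ∑ j, c j * (S j y.2 : ℤ) := by
        rw [Finset.mul_sum]
        exact Finset.sum_congr rfl fun j _ => by push_cast; ring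
      rw [this, h, mul_zero]
    · simp
  indep q hq h := by
    refine hS.indep q hq fun x => ?_
    have h1 := h (k, x)
    have : ∑ j, q j * ((u * S j x : ℕ) : ℤ) = u * ∑ j, q j * (S j x : ℤ) := by
      rw [Finset.mul_sum]
      exact Finset.sum_congr rfl fun j _ => by push_cast; ring
    simp only [PseudorandomRado.blockEmbed, if_true] at h1
    rw [this] at h1
    exact (mul_eq_zero.mp h1).resolve_left (by exact_mod_cast hu.ne')

variable {c : Fin s → ℤ} {I : Finset (Fin s)} {i₀ : Fin s} {a R H : ℕ} {b : Fin s × ι → ℕ}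
  {d : Fin s → ι → ℕ}

/-- One integer formula for the three cases: a shift `b + a * R` common to all `k ∈ I`, plus a
correction depending on the block. The bound by `R` ensures that `toNat` truncates nothing. -/
theorem blockSolution_cast (hi₀ : i₀ ∈ I) (y : Fin s × ι)
    (hR : |c i₀ * c y.1 * d y.1 y.2| < R) (k : Fin s) :
    (blockSolution c I i₀ a R b d k y : ℤ) = (if k ∈ I then (b y + a * R : ℤ) else 0) +
      a * (if k = i₀ then (if y.1 = i₀ then 0 else -(c i₀ * c y.1 * d y.1 y.2))
        else if y.1 = k then c i₀ ^ 2 * d y.1 y.2 else 0) := by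
  have hR' := abs_lt.mp hR
  have hnn : (0 : ℤ) ≤ R + (if y.1 = i₀ then 0 else -(c i₀ * c y.1 * d y.1 y.2)) := by
    split_ifs <;> linarith
  unfold blockSolution
  by_cases hk : k = i₀
  · subst hk
    simp only [if_true, hi₀]
    push_cast [Int.toNat_of_nonneg hnn]
    ring
  · simp only [hk, if_false]
    by_cases hkI : k ∈ I <;> by_cases hyk : y.1 = k <;> simp [hkI, hyk, blockEmbed]
    ring

/-- The common shift cancels because the coefficients over `I` sum to zero. In a block `k ≠ i₀` the
corrections of `i₀` and `k` cancel: `c i₀ * (-(c i₀ * c k * d)) + c k * (c i₀ ^ 2 * d) = 0`.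
Independence comes from the separate blocks and a sign argument. -/
theorem isGenericSolution_blockSolution (hc : ∀ j, c j ≠ 0) (hi₀ : i₀ ∈ I)
    (hI : ∑ j ∈ I, c j = 0) (ha : 0 < a) (hd : ∀ k, d k ≠ 0)
    (hR : ∀ k x, |c i₀ * c k * d k x| < R) (hP : ∀ k x, (c i₀).natAbs ^ 2 * d k x ≤ R)
    (hH : ∀ y, b y + a * (2 * R) ≤ H) :
    IsGenericSolution c i₀ H (blockSolution c I i₀ a R b d) where
  ne_zero k h := by
    obtain ⟨x, hx⟩ := Function.ne_iff.mp (hd k)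
    have h1 := congrFun h (k, x)
    have h2 := blockSolution_cast (a := a) (b := b) hi₀ (k, x) (hR k x) k
    have hRpos : (0 : ℤ) < R := (abs_nonneg _).trans_lt (hR k x)
    have hx' : (0 : ℤ) < d k x := by
      simp only [Pi.zero_apply] at hx
      exact_mod_cast Nat.pos_of_ne_zero hx
    have ha' : (0 : ℤ) < a := by exact_mod_cast ha
    have hb : (0 : ℤ) ≤ b (k, x) := by positivity
    have hcp : 0 < c i₀ ^ 2 := by have := hc i₀; positivity
    rw [h1] at h2
    by_cases hk : k = i₀
    · subst hk
      simp only [hi₀, if_true, Pi.zero_apply] at h2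
      push_cast at h2
      nlinarith [mul_pos ha' hRpos]
    · simp only [hk, if_true, if_false, Pi.zero_apply] at h2
      have h3 := mul_pos ha' (mul_pos hcp hx')
      have h4 := mul_pos ha' hRpos
      split_ifs at h2 <;> push_cast at h2 <;> linarith
  le k y := by
    have hR' := abs_lt.mp (hR y.1 y.2)
    have h1 : (R + (if y.1 = i₀ then 0 else -(c i₀ * c y.1 * d y.1 y.2)) : ℤ).toNat ≤ 2 * R := by
      split_ifs <;> omega
    have h2 : (c i₀).natAbs ^ 2 * blockEmbed k (d k) y ≤ R := by
      unfold blockEmbed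
      split_ifs
      · exact hP _ _
      · simp
    refine le_trans ?_ (hH y)
    unfold blockSolution
    by_cases hk : k = i₀
    · rw [if_pos hk]
      exact Nat.add_le_add_left (Nat.mul_le_mul_left a h1) _
    · rw [if_neg hk]
      by_cases hkI : k ∈ I
      · rw [if_pos hkI]
        exact Nat.add_le_add_left (Nat.mul_le_mul_left a (by omega)) _
      · rw [if_neg hkI]
        exact le_trans (Nat.mul_le_mul_left a (by omega)) (Nat.le_add_left _ _)
  sum_eq_zero y := by
    simp only [blockSolution_cast (a := a) (b := b) hi₀ y (hR _ _), mul_add, Finset.sum_add_distrib,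
      mul_ite, mul_zero, Finset.sum_ite_mem, Finset.univ_inter]
    rw [← Finset.sum_add_distrib, ← Finset.sum_congr rfl fun j _ => mul_add (c j) _ _,
      ← Finset.sum_mul, hI, zero_mul, zero_add, Finset.sum_ite, Finset.filter_eq',
      if_pos (Finset.mem_univ _), Finset.sum_singleton, Finset.sum_ite, Finset.sum_const_zero,
      add_zero]
    by_cases hy : y.1 = i₀
    · rw [if_pos hy, zero_add]
      refine Finset.sum_eq_zero fun j hj => ?_
      simp only [Finset.mem_filter] at hj
      exact absurd (hj.2.symm.trans hy) hj.1.2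
    · rw [if_neg hy, Finset.filter_filter]
      have : (Finset.univ.filter fun k => ¬k = i₀ ∧ y.1 = k) = {y.1} := by
        ext k
        simp only [Finset.mem_filter, Finset.mem_univ, true_and, Finset.mem_singleton]
        constructor
        · exact fun h => h.2.symm
        · rintro rfl
          exact ⟨hy, rfl⟩
      rw [this, Finset.sum_singleton]
      ring
  indep q hq h := by
    -- In block `k`, where `d k` is non-zero, only the common shift and the correction of `k`
    -- survive. So each `q k` is zero or opposite in sign to `∑ j ∈ I, q j`; as `q i₀ = 0`, summing
    -- over `I` forces that sum to vanish, and then every `q k`.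
    have key : ∀ k, k ≠ i₀ → ∃ β t : ℤ, 0 ≤ β ∧ 0 < t ∧ (∑ j ∈ I, q j) * β + q k * t = 0 := by
      intro k hk
      obtain ⟨x, hx⟩ := Function.ne_iff.mp (hd k)
      refine ⟨b (k, x) + a * R, a * (c i₀ ^ 2 * d k x), by positivity, ?_, ?_⟩
      · have := hc i₀
        have hx' : (0 : ℤ) < d k x := by
          simp only [Pi.zero_apply] at hx
          exact_mod_cast Nat.pos_of_ne_zero hx
        have ha' : (0 : ℤ) < a := by exact_mod_cast ha
        positivity
      · have h1 := h (k, x)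
        simp only [blockSolution_cast (a := a) (b := b) hi₀ (k, x) (hR k x), mul_add,
          Finset.sum_add_distrib, mul_ite, mul_zero, Finset.sum_ite_mem, Finset.univ_inter] at h1
        rw [← Finset.sum_add_distrib, ← Finset.sum_congr rfl fun j _ => mul_add (q j) _ _,
          ← Finset.sum_mul, Finset.sum_eq_single (s := Finset.univ) k] at h1
        · simpa [hk] using h1
        · intro j _ hj
          by_cases hji : j = i₀
          · simp [hji, hq]
          · simp [hji, hj.symm]
        · simp
    have hQ : ∑ j ∈ I, q j = 0 := by
      rcases lt_trichotomy (∑ j ∈ I, q j) 0 with hlt | heq | hgt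
      · refine absurd (Finset.sum_nonneg fun j _ => ?_) (not_le.mpr hlt)
        by_cases hj : j = i₀
        · simp [hj, hq]
        · obtain ⟨β, t, hβ, ht, h1⟩ := key j hj
          nlinarith [mul_nonneg hβ (neg_nonneg.mpr hlt.le)]
      · exact heq
      · refine absurd (Finset.sum_nonpos fun j _ => ?_) (not_le.mpr hgt)
        by_cases hj : j = i₀
        · simp [hj, hq]
        · obtain ⟨β, t, hβ, ht, h1⟩ := key j hj
          nlinarith [mul_nonneg hβ hgt.le]
    ext k
    by_cases hk : k = i₀
    · simp [hk, hq]
    · obtain ⟨β, t, -, ht, h1⟩ := key k hk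
      rw [hQ, zero_mul, zero_add] at h1
      exact (mul_eq_zero.mp h1).resolve_right ht.ne'

end Blocks

/-! ### Rado's theorem for forms by colour induction -/

/-- Rado's theorem for the equation `∑ c_j x_j = 0`, for vectors in a box instead of integers, and
with a generic solution: by induction on the number `k` of colours used. -/
theorem exists_mono_genericSolution {s : ℕ} {c : Fin s → ℤ} (hc : ∀ j, c j ≠ 0)
    {I : Finset (Fin s)} {i₀ : Fin s} (hi₀ : i₀ ∈ I) (hI : ∑ j ∈ I, c j = 0) (r k : ℕ) :
    ∃ (ι : Type) (_ : Fintype ι) (_ : Nonempty ι) (H : ℕ), ∀ (χ : (ι → ℕ) → Fin r) (E : Finset (Fin r)),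
      E.card ≤ k → (∀ v : ι → ℕ, v ≠ 0 → (∀ y, v y ≤ H) → χ v ∈ E) →
        ∃ S : Fin s → ι → ℕ, IsGenericSolution c i₀ H S ∧ ∃ e, ∀ j, χ (S j) = e := by
  classical
  induction k with
  | zero =>
    refine ⟨Unit, inferInstance, inferInstance, 1, fun χ E hE hχ => ?_⟩
    have h := hχ (fun _ => 1) (fun h => by simpa using congrFun h ()) (fun _ => le_rfl)
    rw [Finset.card_eq_zero.mp (Nat.le_zero.mp hE)] at h
    exact absurd h (Finset.notMem_empty _)
  | succ k ih =>
    obtain ⟨ι, _, _, H, ih⟩ := ih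
    set C : ℕ := ∑ j, (c j).natAbs with hC
    have hCj : ∀ j, (c j).natAbs ≤ C := fun j =>
      Finset.single_le_sum (f := fun j => (c j).natAbs) (fun _ _ => Nat.zero_le _)
        (Finset.mem_univ j)
    -- All corrections have size less than `R`, so after shifting by `R` they lie in the box `[0,
    -- 2R]`.
    set R : ℕ := C * C * H + 1 with hRdef
    obtain ⟨m, hm⟩ := exists_bounded_mono_homothetic_box (Fin s × ι) r (2 * R)
    set H' : ℕ := m + m * (2 * R) with hH'
    have hscale : ∀ a ≤ m, a * (c i₀).natAbs ^ 2 * H ≤ H' := fun a ha => by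
      calc a * (c i₀).natAbs ^ 2 * H ≤ m * C ^ 2 * H := by gcongr; exact hCj i₀
        _ = m * (C * C * H) := by ring
        _ ≤ m * (2 * R) := Nat.mul_le_mul_left _ (by rw [hRdef]; linarith)
        _ ≤ H' := Nat.le_add_left _ _
    refine ⟨Fin s × ι, inferInstance, ⟨(i₀, Classical.arbitrary ι)⟩, H', fun χ E hE hχ => ?_⟩
    obtain ⟨a, b, e, ha, ham, hbm, he⟩ := hm χ
    -- Either every block contains a scaled vector of the box's colour `e`, and the block solution
    -- is monochromatic, or some block avoids `e` altogether and its pulled-back colouring has one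
    -- colour fewer.
    by_cases hcase : ∀ j : Fin s, ∃ d : ι → ℕ, d ≠ 0 ∧ (∀ x, d x ≤ H) ∧
        χ (fun y => a * (c i₀).natAbs ^ 2 * blockEmbed j d y) = e
    · choose d hd0 hdH hde using hcase
      have hRlt : ∀ k x, (c i₀ * c k * d k x).natAbs < R := fun k x => by
        rw [Int.natAbs_mul, Int.natAbs_mul, Int.natAbs_natCast, hRdef, Nat.lt_succ_iff]
        gcongr
        exacts [hCj _, hCj _, hdH _ _]
      have hR : ∀ k x, |c i₀ * c k * d k x| < R := fun k x => by
        rw [Int.abs_eq_natAbs]; exact_mod_cast hRlt k x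
      have hP : ∀ k x, (c i₀).natAbs ^ 2 * d k x ≤ R := fun k x => by
        rw [sq, hRdef]
        refine le_trans ?_ (Nat.le_succ _)
        gcongr
        exacts [hCj _, hCj _, hdH _ _]
      refine ⟨blockSolution c I i₀ a R b d, isGenericSolution_blockSolution hc hi₀ hI ha hd0 hR hP
        fun y => ?_, e, fun k => ?_⟩
      · exact Nat.add_le_add (hbm y) (Nat.mul_le_mul_right _ ham)
      · by_cases hk : k = i₀
        · subst hk
          have h1 : blockSolution c I k a R b d k = fun y => b y + a *
              (R + (if y.1 = k then 0 else -(c k * c y.1 * d y.1 y.2))).toNat := by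
            ext y; rw [blockSolution, if_pos rfl]
          rw [h1]
          refine he _ fun y => ?_
          have := hRlt y.1 y.2
          split_ifs <;> omega
        · by_cases hkI : k ∈ I
          · have h1 : blockSolution c I i₀ a R b d k = fun y =>
                b y + a * (R + (c i₀).natAbs ^ 2 * blockEmbed k (d k) y) := by
              ext y; simp [blockSolution, hk, hkI]
            rw [h1]
            refine he _ fun y => ?_
            have : (c i₀).natAbs ^ 2 * blockEmbed k (d k) y ≤ R := by
              unfold blockEmbed
              split_ifs
              · exact hP _ _
              · simp
            omega
          · have h1 : blockSolution c I i₀ a R b d k = fun y =>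
                a * (c i₀).natAbs ^ 2 * blockEmbed k (d k) y := by
              ext y; simp [blockSolution, hk, hkI, mul_assoc]
            rw [h1]
            exact hde k
    · push Not at hcase
      obtain ⟨j, hj⟩ := hcase
      have hu : 0 < a * (c i₀).natAbs ^ 2 := by
        have := Int.natAbs_pos.mpr (hc i₀)
        positivity
      have heE : e ∈ E := by
        rw [← he (fun _ => 1) fun _ => by omega]
        refine hχ _ (fun h => ?_) fun y => ?_
        · have := congrFun h (i₀, Classical.arbitrary ι)
          simp only [Pi.zero_apply] at this
          omega
        · exact Nat.add_le_add (hbm y) (Nat.mul_le_mul ham (by omega))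
      have hmem : ∀ v : ι → ℕ, v ≠ 0 → (∀ x, v x ≤ H) →
          χ (fun y => a * (c i₀).natAbs ^ 2 * blockEmbed j v y) ∈ E.erase e := by
        refine fun v hv hvH => Finset.mem_erase.mpr ⟨hj v hv hvH, hχ _ (fun h => hv ?_) fun y => ?_⟩
        · ext x
          have := congrFun h (j, x)
          simp only [blockEmbed, if_true, Pi.zero_apply, mul_eq_zero] at this
          exact this.resolve_left (by simpa using hu.ne')
        · refine le_trans (Nat.mul_le_mul_left _ ?_) (hscale a ham)
          unfold blockEmbed
          split_ifs
          · exact hvH _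
          · exact Nat.zero_le _
      obtain ⟨S, hS, e', he'⟩ := ih _ (E.erase e)
        (by rw [Finset.card_erase_of_mem heE]; omega) hmem
      exact ⟨_, hS.blockEmbed j hu (hscale a ham), e', he'⟩

/-! ### Counting monochromatic integer solutions -/

/-- Linearly independent integer vectors have an integer dual system, up to a non-zero scalar. -/
theorem exists_dual_system {κ ι : Type*} [Fintype κ] [DecidableEq κ] [Fintype ι] (A : Matrix κ ι ℤ)
    (hA : ∀ q : κ → ℤ, Matrix.vecMul q A = 0 → q = 0) :
    ∃ (m : ℤ) (B : Matrix ι κ ℤ), m ≠ 0 ∧ A * B = m • (1 : Matrix κ κ ℤ) := by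
  -- The Gram determinant is non-zero: a vector `v` killing the Gram matrix satisfies `|v A|² = 0`.
  refine ⟨(A * A.transpose).det, A.transpose * (A * A.transpose).adjugate, fun h => ?_, ?_⟩
  · obtain ⟨v, hv, hvA⟩ := Matrix.exists_vecMul_eq_zero_iff.mpr h
    refine hv (hA v ?_)
    have h1 : dotProduct (Matrix.vecMul v A) (Matrix.vecMul v A) = 0 := by
      rw [← Matrix.mulVec_transpose A v, Matrix.dotProduct_mulVec, Matrix.mulVec_transpose,
        Matrix.vecMul_vecMul, hvA, zero_dotProduct]
    exact dotProduct_self_eq_zero.mp h1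
  · rw [← Matrix.mul_assoc, Matrix.mul_adjugate]

theorem IsGenericSolution.exists_dual {s : ℕ} {c : Fin s → ℤ} {i₀ : Fin s} {ι : Type} [Fintype ι]
    {H : ℕ} {S : Fin s → ι → ℕ} (hS : IsGenericSolution c i₀ H S) :
    ∃ (m : ℤ) (u : Fin s → ι → ℤ), m ≠ 0 ∧
      ∀ j, j ≠ i₀ → ∀ k, ∑ y, (S j y : ℤ) * u k y = if j = k then m else 0 := by
  classical
  obtain ⟨m, B, hm, hB⟩ := exists_dual_system
    (Matrix.of fun (j : {j : Fin s // j ≠ i₀}) (y : ι) => (S j y : ℤ)) fun q hq => by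
      have := hS.indep (fun j => if h : j ≠ i₀ then q ⟨j, h⟩ else 0) (by simp) fun y => by
        have h1 := congrFun hq y
        simp only [Matrix.vecMul, dotProduct, Matrix.of_apply, Pi.zero_apply] at h1
        refine Eq.trans ?_ h1
        have h2 := Finset.sum_subtype (Finset.univ.filter fun j => j ≠ i₀)
          (p := fun j => j ≠ i₀) (F := inferInstance) (by simp)
          fun j => (if h : j ≠ i₀ then q ⟨j, h⟩ else 0) * (S j y : ℤ)
        rw [Finset.sum_filter_of_ne fun j _ hj => by contrapose hj; simp [hj]] at h2
        rw [h2]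
        exact Finset.sum_congr rfl fun j _ => by rw [dif_pos j.2]
      ext j
      simpa [j.2] using congrFun this j
  refine ⟨m, fun k y => if h : k ≠ i₀ then B y ⟨k, h⟩ else 0, hm, fun j hj k => ?_⟩
  by_cases hk : k = i₀
  · subst hk
    simp [hj]
  · have h1 := congrFun (congrFun hB ⟨j, hj⟩) ⟨k, hk⟩
    simp only [Matrix.mul_apply, Matrix.of_apply, Matrix.smul_apply, Matrix.one_apply,
      Subtype.mk.injEq, smul_eq_mul, mul_ite, mul_one, mul_zero] at h1
    simpa [hk] using h1

/-- The value at `t` of the linear form with coefficients `v`. -/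
def evalForm {ι : Type} [Fintype ι] (v : ι → ℕ) (t : ι → ℤ) : ℤ := ∑ y, (v y : ℤ) * t y

/-- Shift each `t` in the fibre by `∑ k, z k * u k`, with `u` the dual system and `z ∈ [0, n)^s`.
Applying `S j` to the result gives `x j + m * z j`, which recovers `z j` for `j ≠ i₀`; recording `z
i₀` makes the map injective into a set of size `O(n ^ (card ι + 1))`. -/
theorem IsGenericSolution.card_fiber_le {s : ℕ} {c : Fin s → ℤ} {i₀ : Fin s} {ι : Type} [Fintype ι]
    [DecidableEq ι] {H : ℕ} {S : Fin s → ι → ℕ} (hS : IsGenericSolution c i₀ H S) :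
    ∃ C : ℕ, ∀ n : ℕ, 0 < n → ∀ x : Fin s → ℤ,
      ((Fintype.piFinset fun _ : ι => Finset.Ico (n : ℤ) (2 * n)).filter
        fun t => ∀ j, evalForm (S j) t = x j).card * n ^ s ≤ C * (n ^ Fintype.card ι * n) := by
  classical
  obtain ⟨m, u, hm, hu⟩ := hS.exists_dual
  set B : ℤ := 2 + ∑ k, ∑ y, |u k y| with hB
  have hB0 : 0 ≤ B := by positivity
  refine ⟨(2 * B + 1).toNat ^ Fintype.card ι, fun n hn x => ?_⟩
  have hn' : (1 : ℤ) ≤ n := by exact_mod_cast hn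
  have hcard := Finset.card_le_card_of_injOn
    (s := ((Fintype.piFinset fun _ : ι => Finset.Ico (n : ℤ) (2 * n)).filter
        fun t => ∀ j, evalForm (S j) t = x j) ×ˢ
        Fintype.piFinset fun _ : Fin s => Finset.Ico (0 : ℤ) n)
    (t := (Fintype.piFinset fun _ : ι => Finset.Icc (-(B * n)) (B * n)) ×ˢ Finset.Ico (0 : ℤ) n)
    (fun p => (fun y => p.1 y + ∑ k, p.2 k * u k y, p.2 i₀)) ?_ ?_
  · simp only [Finset.card_product, Fintype.card_piFinset, Int.card_Ico, Int.card_Icc,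
      Finset.prod_const, Finset.card_univ, Fintype.card_fin, sub_zero, Int.toNat_natCast] at hcard
    refine hcard.trans ?_
    rw [← mul_assoc, ← mul_pow]
    refine Nat.mul_le_mul_right _ (Nat.pow_le_pow_left ?_ _)
    zify
    have hBn : 0 ≤ B * n := by positivity
    rw [Int.toNat_of_nonneg (by linarith), Int.toNat_of_nonneg (by linarith)]
    nlinarith
  · rintro ⟨t, z⟩ hp
    simp only [Finset.coe_product, Set.mem_prod, Finset.mem_coe, Finset.mem_filter,
      Fintype.mem_piFinset, Finset.mem_Ico, Finset.mem_Icc] at hp ⊢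
    refine ⟨fun y => ?_, hp.2 i₀⟩
    have h1 : |∑ k, z k * u k y| ≤ (∑ k, ∑ y, |u k y|) * n := by
      refine (Finset.abs_sum_le_sum_abs _ _).trans ?_
      rw [Finset.sum_mul]
      refine Finset.sum_le_sum fun k _ => ?_
      rw [abs_mul, mul_comm, abs_of_nonneg (hp.2 k).1]
      exact mul_le_mul (Finset.single_le_sum (f := fun y => |u k y|) (fun _ _ => abs_nonneg _)
        (Finset.mem_univ y)) (hp.2 k).2.le (hp.2 k).1 (Finset.sum_nonneg fun _ _ => abs_nonneg _)
    have h2 := abs_le.mp h1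
    have h3 := hp.1.1 y
    constructor <;> nlinarith
  · rintro ⟨t, z⟩ hp ⟨t', z'⟩ hp' heq
    simp only [Finset.coe_product, Set.mem_prod, Finset.mem_coe, Finset.mem_filter] at hp hp'
    simp only [Prod.mk.injEq] at heq
    have hev : ∀ (t : ι → ℤ) (z : Fin s → ℤ) (j : Fin s), j ≠ i₀ →
        evalForm (S j) (fun y => t y + ∑ k, z k * u k y) = evalForm (S j) t + m * z j := by
      intro t z j hj
      simp only [evalForm, mul_add, Finset.sum_add_distrib, Finset.mul_sum]
      rw [Finset.sum_comm]
      congr 1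
      calc ∑ k, ∑ y, (S j y : ℤ) * (z k * u k y) = ∑ k, z k * ∑ y, (S j y : ℤ) * u k y := by
            refine Finset.sum_congr rfl fun k _ => ?_
            rw [Finset.mul_sum]
            exact Finset.sum_congr rfl fun y _ => by ring
        _ = m * z j := by simp only [hu j hj]; simp [mul_comm]
    have hz : z = z' := by
      ext j
      by_cases hj : j = i₀
      · rw [hj, heq.2]
      · have h1 := hev t z j hj
        rw [heq.1, hev t' z' j hj, hp.1.2 j, hp'.1.2 j] at h1
        exact (mul_left_cancel₀ hm (add_left_cancel h1)).symm
    subst hz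
    refine Prod.ext (funext fun y => ?_) rfl
    simpa using congrFun heq.1 y

/-- Quantitative Rado theorem (Frankl, Graham and Rödl) for a single equation: a positive
proportion of all solutions is monochromatic. -/
theorem card_mono_solutions_ge {s : ℕ} {c : Fin s → ℤ} (hc : ∀ j, c j ≠ 0) {I : Finset (Fin s)}
    (hne : I.Nonempty) (hI : ∑ j ∈ I, c j = 0) (r : ℕ) :
    ∃ Q C : ℕ, 0 < Q ∧ ∀ n : ℕ, 0 < n → ∀ χ : ℤ → Fin r,
      n ^ s ≤ C * (n * ((Fintype.piFinset fun _ : Fin s => Finset.Icc (n : ℤ) (Q * n)).filter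
        fun x => ∑ j, c j * x j = 0 ∧ ∃ e, ∀ j, χ (x j) = e).card) := by
  classical
  obtain ⟨i₀, hi₀⟩ := hne
  obtain ⟨ι, _, _, H, hmono⟩ := exists_mono_genericSolution hc hi₀ hI r r
  set 𝒮 : Finset (Fin s → ι → ℕ) := (Fintype.piFinset fun _ => Fintype.piFinset fun _ =>
    Finset.range (H + 1)).filter fun S => IsGenericSolution c i₀ H S with h𝒮
  have hfib : ∀ S : Fin s → ι → ℕ, ∃ C : ℕ, IsGenericSolution c i₀ H S → ∀ n : ℕ, 0 < n →
      ∀ x : Fin s → ℤ, ((Fintype.piFinset fun _ : ι => Finset.Ico (n : ℤ) (2 * n)).filter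
        fun t => ∀ j, evalForm (S j) t = x j).card * n ^ s ≤ C * (n ^ Fintype.card ι * n) := by
    intro S
    by_cases hS : IsGenericSolution c i₀ H S
    · obtain ⟨C, hC⟩ := hS.card_fiber_le
      exact ⟨C, fun _ => hC⟩
    · exact ⟨0, fun h => absurd h hS⟩
  choose C hC using hfib
  -- A form with coefficients at most `H` is at most `card ι * H * 2n` on the box; the `+ 1` keeps
  -- `Q` positive.
  refine ⟨Fintype.card ι * (H * 2) + 1, ∑ S ∈ 𝒮, C S, Nat.succ_pos _, fun n hn χ => ?_⟩
  set 𝓜 := (Fintype.piFinset fun _ : Fin s =>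
    Finset.Icc (n : ℤ) ((Fintype.card ι * (H * 2) + 1 : ℕ) * n)).filter
        fun x => ∑ j, c j * x j = 0 ∧ ∃ e, ∀ j, χ (x j) = e with h𝓜
  set box := Fintype.piFinset fun _ : ι => Finset.Ico (n : ℤ) (2 * n) with hbox
  -- Every `t` in the box induces the colouring `v ↦ χ (evalForm v t)` of forms, so it lies in the
  -- fibre of some generic `S` over a monochromatic solution. There are boundedly many `S`, and each
  -- fibre is small.
  have hsub : box ⊆ 𝒮.biUnion fun S => 𝓜.biUnion fun x =>
      box.filter fun t => ∀ j, evalForm (S j) t = x j := by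
    intro t ht
    have ht' : ∀ y, (n : ℤ) ≤ t y ∧ t y < 2 * n := by simpa [hbox] using ht
    obtain ⟨S, hS, e, he⟩ := hmono (fun v => χ (evalForm v t)) Finset.univ (by simp)
      fun _ _ _ => Finset.mem_univ _
    simp only [Finset.mem_biUnion, Finset.mem_filter]
    refine ⟨S, ?_, fun j => evalForm (S j) t, ?_, ht, fun _ => rfl⟩
    · simp only [h𝒮, Finset.mem_filter, Fintype.mem_piFinset, Finset.mem_range, Nat.lt_succ_iff]
      exact ⟨hS.le, hS⟩
    · simp only [h𝓜, Finset.mem_filter, Fintype.mem_piFinset, Finset.mem_Icc]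
      refine ⟨fun j => ⟨?_, ?_⟩, ?_, e, he⟩
      · obtain ⟨y, hy⟩ := Function.ne_iff.mp (hS.ne_zero j)
        have hy' : (1 : ℤ) ≤ S j y := by
          simp only [Pi.zero_apply] at hy
          exact_mod_cast Nat.one_le_iff_ne_zero.mpr hy
        calc (n : ℤ) ≤ S j y * t y := by nlinarith [(ht' y).1]
          _ ≤ _ := Finset.single_le_sum (f := fun y => (S j y : ℤ) * t y)
            (fun y _ => mul_nonneg (by positivity) (le_trans (by positivity) (ht' y).1))
            (Finset.mem_univ y)
      · calc evalForm (S j) t ≤ ∑ _y : ι, (H : ℤ) * (2 * n) := by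
              refine Finset.sum_le_sum fun y _ => ?_
              exact mul_le_mul (by exact_mod_cast hS.le j y) (ht' y).2.le
                (le_trans (by positivity) (ht' y).1) (by positivity)
          _ = Fintype.card ι * (H * 2) * n := by simp; ring
          _ ≤ _ := by push_cast; linarith [Int.natCast_nonneg n]
      · simp only [evalForm, Finset.mul_sum]
        rw [Finset.sum_comm]
        refine Finset.sum_eq_zero fun y _ => ?_
        calc ∑ j, c j * ((S j y : ℤ) * t y) = (∑ j, c j * (S j y : ℤ)) * t y := by
              rw [Finset.sum_mul]
              exact Finset.sum_congr rfl fun j _ => by ring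
          _ = 0 := by rw [hS.sum_eq_zero, zero_mul]
  have hboxcard : box.card = n ^ Fintype.card ι := by
    simp only [hbox, Fintype.card_piFinset, Int.card_Ico, Finset.prod_const, Finset.card_univ]
    congr 1
    omega
  have h1 : n ^ Fintype.card ι * n ^ s ≤
      n ^ Fintype.card ι * ((∑ S ∈ 𝒮, C S) * (n * 𝓜.card)) := by
    calc n ^ Fintype.card ι * n ^ s ≤ (∑ S ∈ 𝒮, ∑ x ∈ 𝓜,
          (box.filter fun t => ∀ j, evalForm (S j) t = x j).card) * n ^ s := by
          rw [← hboxcard]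
          gcongr
          refine (Finset.card_le_card hsub).trans (Finset.card_biUnion_le.trans ?_)
          exact Finset.sum_le_sum fun S _ => Finset.card_biUnion_le
      _ = ∑ S ∈ 𝒮, ∑ x ∈ 𝓜,
          (box.filter fun t => ∀ j, evalForm (S j) t = x j).card * n ^ s := by
          simp only [Finset.sum_mul]
      _ ≤ ∑ S ∈ 𝒮, ∑ x ∈ 𝓜, C S * (n ^ Fintype.card ι * n) :=
          Finset.sum_le_sum fun S hS => Finset.sum_le_sum fun x _ =>
            hC S (Finset.mem_filter.mp hS).2 n hn x
      _ = _ := by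
          simp only [Finset.sum_const, smul_eq_mul, ← Finset.mul_sum, ← Finset.sum_mul]
          ring
  exact Nat.le_of_mul_le_mul_left h1 (by positivity)

/-! ### Fourier analysis on the circle -/

/-- The trigonometric polynomial `∑ f(x) e(α x)`, the sum being over a finite set of integers. -/
noncomputable def trigSum (W : Finset ℤ) (f : ℤ → ℂ) (α : UnitAddCircle) : ℂ :=
  ∑ x ∈ W, f x * fourier x α

theorem norm_fourier_apply (n : ℤ) (α : UnitAddCircle) : ‖(fourier n α : ℂ)‖ = 1 := by
  rw [fourier_apply]
  exact Circle.norm_coe _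

theorem integrable_of_continuous {E : Type*} [NormedAddCommGroup E] {f : UnitAddCircle → E}
    (hf : Continuous f) : Integrable f :=
  hf.integrable_of_hasCompactSupport (HasCompactSupport.of_compactSpace f)

theorem integral_fourier_eq (n : ℤ) :
    ∫ α : UnitAddCircle, (fourier n α : ℂ) = if n = 0 then 1 else 0 := by
  split_ifs with h
  · subst h
    simp only [fourier_zero, integral_const]
    simp [Measure.real]
  · exact integral_eq_zero_of_add_right_eq_neg (fourier_add_half_inv_index h one_pos)

theorem continuous_trigSum (W : Finset ℤ) (f : ℤ → ℂ) : Continuous (trigSum W f) :=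
  continuous_finsetSum _ fun x _ => continuous_const.mul (fourier x).continuous

theorem fourier_zsmul (n m : ℤ) (α : UnitAddCircle) :
    (fourier n (m • α) : ℂ) = fourier (m * n) α := by
  rw [fourier_apply, fourier_apply, smul_smul, mul_comm]

theorem fourier_sum {ι : Type*} (A : Finset ι) (n : ι → ℤ) (α : UnitAddCircle) :
    (fourier (∑ j ∈ A, n j) α : ℂ) = ∏ j ∈ A, (fourier (n j) α : ℂ) := by
  classical
  induction A using Finset.induction_on with
  | empty => simp
  | insert a A ha ih => rw [Finset.sum_insert ha, Finset.prod_insert ha, fourier_add, ih]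

theorem fourier_sub_eq (a b : ℤ) (α : UnitAddCircle) :
    (fourier (a - b) α : ℂ) = fourier a α * (starRingEnd ℂ) (fourier b α) := by
  rw [sub_eq_add_neg, fourier_add, fourier_neg]

theorem norm_fourier_sub_one_le (n : ℤ) (α : UnitAddCircle) :
    ‖(fourier n α : ℂ) - 1‖ ≤ 2 * Real.pi * ‖n • α‖ := by
  obtain ⟨t, ht⟩ := QuotientAddGroup.mk_surjective (n • α)
  have hr : ((t - round t : ℝ) : UnitAddCircle) = n • α := by
    rw [← ht]
    have : ((round t : ℝ) : UnitAddCircle) = 0 := by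
      rw [AddCircle.coe_eq_zero_iff]
      exact ⟨round t, by simp⟩
    rw [AddCircle.coe_sub, this, sub_zero]
  have h1 : ‖n • α‖ = |t - round t| := by
    rw [← ht]
    exact UnitAddCircle.norm_eq
  rw [fourier_apply, ← hr, AddCircle.toCircle_apply_mk, Circle.coe_exp, hr, h1]
  have h2 := Real.norm_exp_I_mul_ofReal_sub_one_le (x := 2 * Real.pi / 1 * (t - round t))
  rw [mul_comm Complex.I] at h2
  refine h2.trans (le_of_eq ?_)
  rw [Real.norm_eq_abs, div_one, abs_mul, abs_of_pos (by positivity : 0 < 2 * Real.pi)]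

theorem norm_fourier_sub_le (n : ℤ) (α β : UnitAddCircle) :
    ‖(fourier n α : ℂ) - fourier n β‖ ≤ 2 * Real.pi * (|(n : ℝ)| * ‖α - β‖) := by
  have h : (fourier n α : ℂ) - fourier n β = fourier n β * (fourier n (α - β) - 1) := by
    rw [mul_sub, mul_one, fourier_apply, fourier_apply, fourier_apply, zsmul_sub, ← Circle.coe_mul,
      ← AddCircle.toCircle_add, add_sub_cancel]
  rw [h, norm_mul, norm_fourier_apply, one_mul]
  refine (norm_fourier_sub_one_le n _).trans ?_
  gcongr
  exact norm_zsmul_le n (α - β)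

theorem norm_trigSum_sub_le {N : ℕ} (f : ℤ → ℂ) (α β : UnitAddCircle) :
    ‖trigSum (interval N) f α - trigSum (interval N) f β‖ ≤
      (∑ x ∈ interval N, ‖f x‖) * (2 * Real.pi * (N * ‖α - β‖)) := by
  rw [trigSum, trigSum, ← Finset.sum_sub_distrib, Finset.sum_mul]
  refine norm_sum_le_of_le _ fun x hx => ?_
  rw [← mul_sub, norm_mul]
  refine mul_le_mul_of_nonneg_left ((norm_fourier_sub_le x α β).trans ?_) (norm_nonneg _)
  gcongr
  have := Finset.mem_Icc.mp hx
  rw [abs_of_nonneg (by exact_mod_cast (by omega : 0 ≤ x))]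
  exact_mod_cast this.2

theorem norm_trigSum_le (W : Finset ℤ) (f : ℤ → ℂ) (α : UnitAddCircle) :
    ‖trigSum W f α‖ ≤ ∑ x ∈ W, ‖f x‖ :=
  norm_sum_le_of_le _ fun x _ => by rw [norm_mul, norm_fourier_apply, mul_one]

/-- Fourier analytic expression of a weighted number of solutions. -/
theorem integral_prod_trigSum {s : ℕ} (c : Fin s → ℤ) (W : Finset ℤ) (f : ℤ → ℝ) :
    ∫ α : UnitAddCircle, ∏ j, trigSum W (fun x => (f x : ℂ)) (c j • α) =
      ((∑ x ∈ (Fintype.piFinset fun _ => W).filter fun x => ∑ j, c j * x j = 0,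
        ∏ j, f (x j) : ℝ) : ℂ) := by
  classical
  have h : ∀ α : UnitAddCircle, ∏ j, trigSum W (fun x => (f x : ℂ)) (c j • α) =
      ∑ x ∈ Fintype.piFinset fun _ : Fin s => W,
        (∏ j, (f (x j) : ℂ)) * fourier (∑ j, c j * x j) α := by
    intro α
    simp only [trigSum, Finset.prod_univ_sum, fourier_zsmul, Finset.prod_mul_distrib, fourier_sum]
  simp only [h]
  rw [integral_finsetSum]
  · simp only [integral_const_mul, integral_fourier_eq, mul_ite, mul_one, mul_zero]
    rw [← Finset.sum_filter]
    push_cast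
    rfl
  · exact fun x _ => (integrable_of_continuous (fourier _).continuous).const_mul _

/-! ### Averaging over a difference set -/

/-- The average of the translates of `f` by `A - A`. -/
noncomputable def averageDiff (A : Finset ℤ) (f : ℤ → ℝ) (x : ℤ) : ℝ :=
  (∑ a ∈ A, ∑ b ∈ A, f (x + a - b)) / (A.card : ℝ) ^ 2

/-- The multiplier by which averaging over `A - A` acts on Fourier transforms. -/
noncomputable def fejerWeight (A : Finset ℤ) (α : UnitAddCircle) : ℝ :=
  ‖∑ a ∈ A, (fourier a α : ℂ)‖ ^ 2 / (A.card : ℝ) ^ 2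

theorem fejerWeight_eq_sum (A : Finset ℤ) (α : UnitAddCircle) :
    (fejerWeight A α : ℂ) = (∑ a ∈ A, ∑ b ∈ A, (fourier (b - a) α : ℂ)) / (A.card : ℂ) ^ 2 := by
  rw [fejerWeight]
  push_cast
  rw [← Complex.mul_conj', map_sum, Finset.sum_mul_sum, Finset.sum_comm]
  simp only [fourier_sub_eq]

theorem fejerWeight_nonneg (A : Finset ℤ) (α : UnitAddCircle) : 0 ≤ fejerWeight A α := by
  unfold fejerWeight; positivity

theorem fejerWeight_le_one (A : Finset ℤ) (α : UnitAddCircle) : fejerWeight A α ≤ 1 := by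
  refine div_le_one_of_le₀ (pow_le_pow_left₀ (norm_nonneg _) ?_ 2) (by positivity)
  refine (norm_sum_le _ _).trans (le_of_eq ?_)
  simp only [norm_fourier_apply, Finset.sum_const, nsmul_eq_mul, mul_one]

theorem continuous_fejerWeight (A : Finset ℤ) : Continuous (fejerWeight A) := by
  unfold fejerWeight
  have : Continuous fun α : UnitAddCircle => ∑ a ∈ A, (fourier a α : ℂ) :=
    continuous_finsetSum _ fun a _ => (fourier a).continuous
  fun_prop

/-- Parseval: only the diagonal frequencies `b - a = 0` survive. -/
theorem integral_fejerWeight {A : Finset ℤ} (hA : A.Nonempty) :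
    ∫ α, fejerWeight A α = (A.card : ℝ)⁻¹ := by
  have hA' : (A.card : ℂ) ≠ 0 := by simpa using hA.ne_empty
  have h : ∫ α, (fejerWeight A α : ℂ) = (A.card : ℂ)⁻¹ := by
    simp only [fejerWeight_eq_sum]
    rw [integral_div, integral_finsetSum]
    · have h1 : ∀ a ∈ A, ∫ α : UnitAddCircle, ∑ b ∈ A, (fourier (b - a) α : ℂ) = 1 := by
        intro a ha
        rw [integral_finsetSum]
        · simp only [integral_fourier_eq, sub_eq_zero, Finset.sum_ite_eq', ha, if_true]
        · exact fun b _ => integrable_of_continuous (fourier _).continuous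
      rw [Finset.sum_congr rfl h1]
      simp
      field_simp
    · exact fun a _ => integrable_finsetSum _ fun b _ =>
        integrable_of_continuous (fourier _).continuous
  rw [integral_complex_ofReal] at h
  exact Complex.ofReal_injective (by rw [h]; push_cast; rfl)

theorem one_sub_fejerWeight_le {A : Finset ℤ} (hA : A.Nonempty) {α : UnitAddCircle} {τ : ℝ}
    (h : ∀ a ∈ A, ∀ b ∈ A, ‖(b - a) • α‖ ≤ τ) :
    1 - fejerWeight A α ≤ 2 * Real.pi * τ := by
  have hA' : (A.card : ℝ) ≠ 0 := by simpa using hA.ne_empty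
  have hA'' : (A.card : ℂ) ≠ 0 := by simpa using hA.ne_empty
  have h1 : (fejerWeight A α : ℂ) - 1 =
      (∑ a ∈ A, ∑ b ∈ A, ((fourier (b - a) α : ℂ) - 1)) / (A.card : ℂ) ^ 2 := by
    rw [fejerWeight_eq_sum]
    simp only [Finset.sum_sub_distrib, Finset.sum_const, nsmul_eq_mul, mul_one, sub_div]
    congr 1
    field_simp
  have h2 : ‖(fejerWeight A α : ℂ) - 1‖ ≤ 2 * Real.pi * τ := by
    rw [h1, norm_div, div_le_iff₀ (by simpa using pow_pos (Nat.cast_pos.mpr hA.card_pos) 2)]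
    have : ∑ a ∈ A, ∑ b ∈ A, 2 * Real.pi * τ = 2 * Real.pi * τ * ‖(A.card : ℂ) ^ 2‖ := by
      simp
      ring
    rw [← this]
    refine norm_sum_le_of_le _ fun a ha => norm_sum_le_of_le _ fun b hb => ?_
    refine (norm_fourier_sub_one_le _ _).trans ?_
    gcongr
    exact h a ha b hb
  have h3 : ‖(fejerWeight A α : ℂ) - 1‖ = |fejerWeight A α - 1| := by
    rw [← Complex.ofReal_one, ← Complex.ofReal_sub, Complex.norm_real, Real.norm_eq_abs]
  rw [h3] at h2
  linarith [(abs_le.mp h2).1]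

/-- Averaging is a convolution, and convolution becomes multiplication. The set `V` contains every
translate of the support, so no mass is lost. -/
theorem trigSum_averageDiff {A W V : Finset ℤ} {f : ℤ → ℝ} (hf : ∀ x ∉ W, f x = 0)
    (hV : ∀ x ∈ W, ∀ a ∈ A, ∀ b ∈ A, x - a + b ∈ V) (α : UnitAddCircle) :
    trigSum V (fun x => (averageDiff A f x : ℂ)) α =
      trigSum W (fun x => (f x : ℂ)) α * fejerWeight A α := by
  have h : ∀ a ∈ A, ∀ b ∈ A, ∑ x ∈ V, (f (x + a - b) : ℂ) * fourier x α =
      trigSum W (fun x => (f x : ℂ)) α * fourier (b - a) α := by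
    intro a ha b hb
    rw [trigSum, Finset.sum_mul]
    symm
    refine Finset.sum_of_injOn (fun x => x - a + b) (fun x _ y _ hxy => by simpa using hxy)
      (fun x hx => hV x hx a ha b hb) ?_ ?_
    · intro x _ hx
      have : x + a - b ∉ W := fun hW => hx ⟨x + a - b, hW, by ring⟩
      simp [hf _ this]
    · intro x _
      rw [mul_assoc, ← fourier_add]
      congr 2
      · congr 1; ring
      · congr 1; ring
  rw [fejerWeight_eq_sum, mul_div_assoc', Finset.mul_sum]
  simp only [Finset.mul_sum]
  rw [Finset.sum_congr rfl fun a ha => Finset.sum_congr rfl fun b hb => (h a ha b hb).symm]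
  simp only [trigSum, averageDiff, Complex.ofReal_div, Complex.ofReal_sum, div_mul_eq_mul_div,
    ← Finset.sum_div, Finset.sum_mul]
  congr 1
  · rw [Finset.sum_comm]
    refine Finset.sum_congr rfl fun a _ => Finset.sum_comm
  · push_cast; rfl

/-- A function with small Fourier transform has small averages. -/
theorem abs_averageDiff_le {A W V : Finset ℤ} (hA : A.Nonempty) {f : ℤ → ℝ}
    (hf : ∀ x ∉ W, f x = 0) (hV : ∀ x ∈ W, ∀ a ∈ A, ∀ b ∈ A, x - a + b ∈ V) {θ : ℝ}
    (hθ : ∀ α, ‖trigSum W (fun x => (f x : ℂ)) α‖ ≤ θ) {x : ℤ} (hx : x ∈ V) :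
    |averageDiff A f x| ≤ θ / A.card := by
  have h1 : ∫ α : UnitAddCircle, trigSum V (fun x => (averageDiff A f x : ℂ)) α * fourier (-x) α =
      averageDiff A f x := by
    simp only [trigSum, Finset.sum_mul, mul_assoc, ← fourier_add]
    rw [integral_finsetSum]
    · simp only [integral_const_mul, integral_fourier_eq, ← sub_eq_add_neg, sub_eq_zero, mul_ite,
        mul_one, mul_zero, Finset.sum_ite_eq', hx, if_true]
    · exact fun y _ => (integrable_of_continuous (fourier _).continuous).const_mul _
  -- By Fourier inversion the average is at most the `L¹` norm of its transform; the weight has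
  -- integral `1 / A.card`.
  have h2 : ‖(averageDiff A f x : ℂ)‖ ≤ ∫ α, θ * fejerWeight A α := by
    rw [← h1]
    refine norm_integral_le_of_norm_le
      (integrable_of_continuous (continuous_const.mul (continuous_fejerWeight A)))
      (Filter.Eventually.of_forall fun α => ?_)
    rw [norm_mul, norm_fourier_apply, mul_one, trigSum_averageDiff hf hV, norm_mul,
      Complex.norm_real, Real.norm_of_nonneg (fejerWeight_nonneg A α)]
    exact mul_le_mul_of_nonneg_right (hθ α) (fejerWeight_nonneg A α)
  rw [integral_const_mul, integral_fejerWeight hA, Complex.norm_real, Real.norm_eq_abs] at h2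
  rwa [div_eq_mul_inv]

/-! ### Comparison of solution counts -/

theorem one_sub_prod_le_sum {ι : Type*} (A : Finset ι) {w : ι → ℝ} (h0 : ∀ j, 0 ≤ w j)
    (h1 : ∀ j, w j ≤ 1) : 1 - ∏ j ∈ A, w j ≤ ∑ j ∈ A, (1 - w j) := by
  classical
  induction A using Finset.induction_on with
  | empty => simp
  | insert a A ha ih =>
    rw [Finset.prod_insert ha, Finset.sum_insert ha]
    have h2 : ∏ j ∈ A, w j ≤ 1 := Finset.prod_le_one (fun j _ => h0 j) fun j _ => h1 j
    have h3 : 0 ≤ ∏ j ∈ A, w j := Finset.prod_nonneg fun j _ => h0 j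
    nlinarith [h0 a, h1 a]

/-- If each factor `z j` is small unless `w j` is close to `1`, then inserting the weights `w j`
changes the product of the `z j` little. -/
theorem norm_prod_sub_prod_mul_le {s : ℕ} {z : Fin s → ℂ} {w : Fin s → ℝ} {η δ : ℝ}
    (hδ : 0 < δ) (hδ1 : δ ≤ 1) (h0 : ∀ j, 0 ≤ w j) (h1 : ∀ j, w j ≤ 1)
    (hz : ∀ j, ‖z j‖ * (1 - w j) ≤ η) :
    ‖∏ j, z j - ∏ j, z j * w j‖ ≤ s * (η ^ δ * ∑ k, ‖z k‖ ^ ((s : ℝ) - δ)) := by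
  have hprod : ∏ j, z j - ∏ j, z j * (w j : ℂ) = (∏ j, z j) * ((1 - ∏ j, w j : ℝ) : ℂ) := by
    rw [Finset.prod_mul_distrib]
    push_cast
    ring
  have hw : 0 ≤ 1 - ∏ j, w j :=
    sub_nonneg.mpr (Finset.prod_le_one (fun j _ => h0 j) fun j _ => h1 j)
  rw [hprod, norm_mul, norm_prod, Complex.norm_real, Real.norm_of_nonneg hw]
  calc (∏ j, ‖z j‖) * (1 - ∏ j, w j) ≤ (∏ j, ‖z j‖) * ∑ j, (1 - w j) :=
        mul_le_mul_of_nonneg_left (one_sub_prod_le_sum _ h0 h1)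
          (Finset.prod_nonneg fun _ _ => norm_nonneg _)
    _ = ∑ j, (∏ k, ‖z k‖) * (1 - w j) := Finset.mul_sum _ _ _
    _ ≤ ∑ _j : Fin s, η ^ δ * ∑ k, ‖z k‖ ^ ((s : ℝ) - δ) := Finset.sum_le_sum fun j _ => ?_
    _ = s * (η ^ δ * ∑ k, ‖z k‖ ^ ((s : ℝ) - δ)) := by simp
  have hw0 : 0 ≤ 1 - w j := sub_nonneg.mpr (h1 j)
  have hη : 0 ≤ η := (mul_nonneg (norm_nonneg _) hw0).trans (hz j)
  obtain ⟨k, -, hk⟩ := Finset.exists_max_image Finset.univ (fun k => ‖z k‖) ⟨j, Finset.mem_univ j⟩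
  -- Only the power `δ` of the gain `η` is spent. The other `1 - δ` powers stay with `‖z j‖`, so
  -- that the total exponent is `s - δ`, where the restriction estimate applies.
  have hsmall : ‖z j‖ * (1 - w j) ≤ η ^ δ * ‖z j‖ ^ (1 - δ) := by
    calc ‖z j‖ * (1 - w j) = (‖z j‖ * (1 - w j)) ^ δ * (‖z j‖ * (1 - w j)) ^ (1 - δ) := by
          rw [← Real.rpow_add_of_nonneg (mul_nonneg (norm_nonneg _) hw0) hδ.le (by linarith),
            add_sub_cancel, Real.rpow_one]
      _ ≤ _ := by
          have hn := mul_nonneg (norm_nonneg (z j)) hw0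
          refine mul_le_mul (Real.rpow_le_rpow hn (hz j) hδ.le) (Real.rpow_le_rpow hn ?_
            (by linarith)) (by positivity) (by positivity)
          exact mul_le_of_le_one_right (norm_nonneg _) (by linarith [h0 j])
  have hs : (0 : ℝ) ≤ (s : ℝ) - 1 := by
    have : (1 : ℝ) ≤ s := by exact_mod_cast j.pos
    linarith
  calc (∏ k, ‖z k‖) * (1 - w j) = (∏ i ∈ Finset.univ.erase j, ‖z i‖) * (‖z j‖ * (1 - w j)) := by
        rw [← Finset.mul_prod_erase Finset.univ _ (Finset.mem_univ j)]; ring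
    _ ≤ ‖z k‖ ^ ((s : ℝ) - 1) * (η ^ δ * ‖z k‖ ^ (1 - δ)) := by
        have hp : ∏ i ∈ Finset.univ.erase j, ‖z i‖ ≤ ‖z k‖ ^ ((s : ℝ) - 1) := by
          calc ∏ i ∈ Finset.univ.erase j, ‖z i‖ ≤ ∏ _i ∈ Finset.univ.erase j, ‖z k‖ :=
                Finset.prod_le_prod (fun _ _ => norm_nonneg _) fun i _ => hk i (Finset.mem_univ i)
            _ = ‖z k‖ ^ ((s : ℝ) - 1) := by
                rw [Finset.prod_const, Finset.card_erase_of_mem (Finset.mem_univ j),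
                  Finset.card_univ, Fintype.card_fin, ← Real.rpow_natCast,
                  Nat.cast_sub (by have := j.pos; omega), Nat.cast_one]
        refine mul_le_mul hp (hsmall.trans ?_) (mul_nonneg (norm_nonneg _) hw0) (by positivity)
        exact mul_le_mul_of_nonneg_left (Real.rpow_le_rpow (norm_nonneg _)
          (hk j (Finset.mem_univ j)) (by linarith)) (by positivity)
    _ = η ^ δ * ‖z k‖ ^ ((s : ℝ) - δ) := by
        rw [mul_left_comm, ← Real.rpow_add_of_nonneg (norm_nonneg _) hs (by linarith)]
        congr 2
        ring
    _ ≤ _ := by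
        gcongr
        exact Finset.single_le_sum (f := fun k => ‖z k‖ ^ ((s : ℝ) - δ))
          (fun _ _ => by positivity) (Finset.mem_univ k)

theorem integral_comp_zsmul {n : ℤ} (hn : n ≠ 0) {G : UnitAddCircle → ℝ} (hG : Continuous G) :
    ∫ α, G (n • α) = ∫ α, G α := by
  have h := Measure.measurePreserving_zsmul (volume : Measure UnitAddCircle) hn
  conv_rhs => rw [← h.map_eq]
  exact (integral_map h.measurable.aemeasurable hG.aestronglyMeasurable).symm

/-- Replacing a function by an average of its translates hardly changes the number of solutions,
provided that the average has almost the same Fourier transform. -/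
theorem abs_sum_solutions_sub_le {s : ℕ} {c : Fin s → ℤ} (hc : ∀ j, c j ≠ 0) {A W V : Finset ℤ}
    {f : ℤ → ℝ} (hf : ∀ x ∉ W, f x = 0) (hV : ∀ x ∈ W, ∀ a ∈ A, ∀ b ∈ A, x - a + b ∈ V)
    {η δ : ℝ} (hδ : 0 < δ) (hδ1 : δ ≤ 1)
    (hη : ∀ α, ‖trigSum W (fun x => (f x : ℂ)) α‖ * (1 - fejerWeight A α) ≤ η) :
    |∑ x ∈ (Fintype.piFinset fun _ => W).filter (fun x : Fin s → ℤ => ∑ j, c j * x j = 0),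
        ∏ j, f (x j) -
      ∑ x ∈ (Fintype.piFinset fun _ => V).filter (fun x : Fin s → ℤ => ∑ j, c j * x j = 0),
        ∏ j, averageDiff A f (x j)| ≤
      s ^ 2 * η ^ δ * ∫ α, ‖trigSum W (fun x => (f x : ℂ)) α‖ ^ ((s : ℝ) - δ) := by
  rcases Nat.eq_zero_or_pos s with hs0 | hs
  · subst hs0
    simp
  have hs' : (0 : ℝ) ≤ (s : ℝ) - δ := by
    have : (1 : ℝ) ≤ s := by exact_mod_cast hs
    linarith
  set G : UnitAddCircle → ℝ := fun α => ‖trigSum W (fun x => (f x : ℂ)) α‖ ^ ((s : ℝ) - δ) with hG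
  have hGc : Continuous G := (continuous_trigSum W _).norm.rpow_const fun _ => Or.inr hs'
  have hcont : ∀ (U : Finset ℤ) (g : ℤ → ℂ), Continuous fun α => ∏ j, trigSum U g (c j • α) :=
    fun U g => continuous_finsetProd _ fun j _ =>
      (continuous_trigSum U g).comp (continuous_zsmul (c j))
  -- Non-zero integer dilations preserve Haar measure, so the coefficients `c j` do not affect the
  -- moments.
  have hdil : ∀ j, ∫ α, G (c j • α) = ∫ α, G α := fun j => integral_comp_zsmul (hc j) hGc
  rw [← Real.norm_eq_abs, ← Complex.norm_real, Complex.ofReal_sub, ← integral_prod_trigSum,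
    ← integral_prod_trigSum, ← integral_sub (integrable_of_continuous (hcont _ _))
      (integrable_of_continuous (hcont _ _))]
  calc _ ≤ ∫ α, (s : ℝ) * (η ^ δ * ∑ j, G (c j • α)) := by
        refine norm_integral_le_of_norm_le (integrable_of_continuous ?_)
          (Filter.Eventually.of_forall fun α => ?_)
        · exact continuous_const.mul (continuous_const.mul (continuous_finsetSum _ fun j _ =>
            hGc.comp (continuous_zsmul (c j))))
        · simp only [trigSum_averageDiff hf hV]
          exact norm_prod_sub_prod_mul_le hδ hδ1 (fun j => fejerWeight_nonneg A _)
            (fun j => fejerWeight_le_one A _) fun j => hη _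
    _ = _ := by
        have hGi : ∀ j, Integrable fun α => G (c j • α) := fun j =>
          integrable_of_continuous (hGc.comp (continuous_zsmul (c j)))
        rw [integral_const_mul, integral_const_mul, integral_finsetSum _ fun j _ => hGi j]
        simp only [hdil]
        simp
        ring

/-! ### Large spectrum and Bohr sets -/

/-- The large spectrum of a function satisfying a restriction estimate is covered by a bounded
number of arcs of length `≍ 1/N`. -/
theorem exists_spectrum_net {p K ε δ : ℝ} (hp : 0 ≤ p) (hε : 0 < ε) (hδ : 0 < δ)
    (hδ1 : δ ≤ 1) (hδε : 2 * Real.pi * δ ≤ ε) :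
    ∃ B : ℕ, ∀ N : ℕ, 0 < N → ∀ f : ℤ → ℂ, ∑ x ∈ interval N, ‖f x‖ ≤ N →
      ∫ α, ‖trigSum (interval N) f α‖ ^ p ≤ K * (N : ℝ) ^ p * (N : ℝ)⁻¹ →
        ∃ R : Finset UnitAddCircle, R.card ≤ B ∧
          ∀ α, ε * N < ‖trigSum (interval N) f α‖ → ∃ β ∈ R, ‖α - β‖ ≤ δ / N := by
  classical
  refine ⟨⌈K / ((ε / 2) ^ p * δ)⌉₊, fun N hN f hf hint => ?_⟩
  have hN' : (0 : ℝ) < N := by exact_mod_cast hN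
  set F : UnitAddCircle → ℝ := fun α => ‖trigSum (interval N) f α‖ with hF
  have hFc : Continuous fun α => F α ^ p :=
    (continuous_trigSum _ f).norm.rpow_const fun _ => Or.inr hp
  -- The net is a maximal `δ / N`-separated subset of the spectrum. By the Lipschitz bound the
  -- transform stays at least `ε * N / 2` on disjoint arcs of length `δ / N` about its points, and
  -- Markov's inequality bounds their number.
  set valid : Finset UnitAddCircle → Prop := fun R => (∀ α ∈ R, ε * N < F α) ∧
    (R : Set UnitAddCircle).Pairwise fun α β => δ / N < ‖α - β‖ with hvalid
  have hcard : ∀ R, valid R → R.card ≤ ⌈K / ((ε / 2) ^ p * δ)⌉₊ := by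
    rintro R ⟨hR, hsep⟩
    have hdisj : (R : Set UnitAddCircle).PairwiseDisjoint
        fun β => Metric.closedBall β (δ / (2 * N)) := by
      intro α hα β hβ hne
      refine Metric.closedBall_disjoint_closedBall ?_
      rw [dist_eq_norm]
      refine lt_of_eq_of_lt ?_ (hsep hα hβ hne)
      field_simp
      ring
    have hvol : volume.real (⋃ β ∈ R, Metric.closedBall β (δ / (2 * N))) = R.card * (δ / N) := by
      rw [measureReal_biUnion_finset hdisj fun β _ => Metric.isClosed_closedBall.measurableSet]
      have h1 : ∀ β : UnitAddCircle, volume.real (Metric.closedBall β (δ / (2 * N))) = δ / N := by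
        intro β
        have h2 : δ / N ≤ 1 := by
          rw [div_le_one hN']
          exact hδ1.trans (by exact_mod_cast hN)
        have h3 : 2 * (δ / (2 * N)) = δ / N := by field_simp
        rw [measureReal_def, AddCircle.volume_closedBall, h3, min_eq_right h2,
          ENNReal.toReal_ofReal (by positivity)]
      simp [h1]
    have hsub : (⋃ β ∈ R, Metric.closedBall β (δ / (2 * N))) ⊆
        {α | (ε / 2 * N) ^ p ≤ F α ^ p} := by
      intro α hα
      simp only [Set.mem_iUnion, Metric.mem_closedBall, dist_eq_norm] at hα
      obtain ⟨β, hβ, hαβ⟩ := hα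
      refine Real.rpow_le_rpow (by positivity) ?_ hp
      have h1 := norm_trigSum_sub_le (N := N) f β α
      have h2 : (∑ x ∈ interval N, ‖f x‖) * (2 * Real.pi * (N * ‖β - α‖)) ≤
          N * (2 * Real.pi * (N * (δ / (2 * N)))) := by
        rw [norm_sub_rev β α]
        gcongr
      have h3 : N * (2 * Real.pi * (N * (δ / (2 * N)))) = 2 * Real.pi * δ * N / 2 := by
        field_simp
      have h4 : 2 * Real.pi * δ * N / 2 ≤ ε * N / 2 := by gcongr
      have h5 := norm_sub_norm_le (trigSum (interval N) f β) (trigSum (interval N) f α)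
      have h6 := hR β hβ
      simp only [hF] at h6 ⊢
      linarith
    have hmarkov := mul_meas_ge_le_integral_of_nonneg (μ := volume)
      (Filter.Eventually.of_forall fun α => Real.rpow_nonneg (norm_nonneg _) p)
      (integrable_of_continuous hFc) ((ε / 2 * N) ^ p)
    have h1 : (ε / 2 * N) ^ p * (R.card * (δ / N)) ≤ K * (N : ℝ) ^ p * (N : ℝ)⁻¹ := by
      refine le_trans ?_ (hmarkov.trans hint)
      rw [← hvol]
      exact mul_le_mul_of_nonneg_left (measureReal_mono hsub) (by positivity)
    rw [Real.mul_rpow (by positivity) hN'.le] at h1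
    have h2 : (R.card : ℝ) ≤ K / ((ε / 2) ^ p * δ) := by
      rw [le_div_iff₀ (by positivity)]
      have hNp : 0 < (N : ℝ) ^ p * (N : ℝ)⁻¹ := by positivity
      refine le_of_mul_le_mul_right ?_ hNp
      calc _ = (ε / 2) ^ p * (N : ℝ) ^ p * (R.card * (δ / N)) := by
            rw [div_eq_mul_inv δ]; ring
        _ ≤ _ := h1
        _ = _ := by ring
    exact_mod_cast h2.trans (Nat.le_ceil _)
  set cards : Set ℕ := {k | ∃ R, valid R ∧ R.card = k} with hcards
  have hbdd : BddAbove cards := ⟨_, by rintro _ ⟨R, hR, rfl⟩; exact hcard R hR⟩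
  obtain ⟨R, hR, hRmax⟩ := Nat.sSup_mem (s := cards) ⟨0, ∅, by simp [hvalid], rfl⟩ hbdd
  refine ⟨R, hcard R hR, fun α hα => ?_⟩
  by_contra! hcon
  have hαR : α ∉ R := fun h => by
    have := hcon α h
    rw [sub_self, norm_zero] at this
    exact absurd this (not_lt.mpr (by positivity))
  have hins : valid (insert α R) := by
    refine ⟨?_, ?_⟩
    · intro β hβ
      rcases Finset.mem_insert.mp hβ with rfl | hβ
      exacts [hα, hR.1 β hβ]
    · rw [Finset.coe_insert]
      refine hR.2.insert fun β hβ _ => ⟨hcon β hβ, ?_⟩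
      rw [norm_sub_rev]
      exact hcon β hβ
  have := le_csSup hbdd ⟨_, hins, rfl⟩
  rw [← hRmax, Finset.card_insert_of_notMem hαR] at this
  omega

/-- Simultaneous Dirichlet approximation: a positive proportion of `[n]` has all its differences in
a given Bohr set of bounded rank. -/
theorem exists_dense_bohr_differences (B : ℕ) {τ : ℝ} (hτ : 0 < τ) :
    ∃ m : ℕ, 0 < m ∧ ∀ (n : ℕ) (R : Finset UnitAddCircle), R.card ≤ B →
      ∃ A : Finset ℤ, A ⊆ Finset.Icc 1 (n : ℤ) ∧ n ≤ m * A.card ∧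
        ∀ a ∈ A, ∀ b ∈ A, ∀ β ∈ R, ‖(b - a) • β‖ ≤ τ := by
  classical
  obtain ⟨T, -, hTfin, hT⟩ := (isCompact_univ (X := UnitAddCircle)).finite_cover_balls (half_pos hτ)
  lift T to Finset UnitAddCircle using hTfin
  have hκ : ∀ β : UnitAddCircle, ∃ t ∈ T, dist β t < τ / 2 := fun β => by
    simpa using hT (Set.mem_univ β)
  choose κ hκT hκd using hκ
  have hTpos : 0 < T.card := Finset.card_pos.mpr ⟨_, hκT 0⟩
  refine ⟨T.card ^ B, pow_pos hTpos B, fun n R hR => ?_⟩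
  set P : Finset (R → UnitAddCircle) := Fintype.piFinset fun _ => T with hP
  -- Sort `[n]` by the centres of `τ / 2`-balls containing the multiples `a • β`. There are at most
  -- `T.card ^ B` cells, and a largest one is the required set.
  set cell : ℤ → R → UnitAddCircle := fun a β => κ (a • (β : UnitAddCircle)) with hcell
  have hmaps : ∀ a ∈ Finset.Icc 1 (n : ℤ), cell a ∈ P := fun a _ =>
    Fintype.mem_piFinset.mpr fun β => hκT _
  obtain ⟨y, -, hy⟩ := Finset.exists_max_image P
    (fun y => ((Finset.Icc 1 (n : ℤ)).filter fun a => cell a = y).card)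
    ⟨fun _ => κ 0, Fintype.mem_piFinset.mpr fun _ => hκT _⟩
  refine ⟨(Finset.Icc 1 (n : ℤ)).filter fun a => cell a = y, Finset.filter_subset _ _, ?_, ?_⟩
  · have h1 := Finset.card_le_mul_card_image_of_maps_to hmaps _ hy
    have h2 : P.card ≤ T.card ^ B := by
      simp only [hP, Fintype.card_piFinset, Finset.prod_const, Finset.card_univ, Fintype.card_coe]
      exact Nat.pow_le_pow_right hTpos hR
    simp only [Int.card_Icc, add_sub_cancel_right, Int.toNat_natCast] at h1
    rw [mul_comm]
    exact h1.trans (Nat.mul_le_mul_left _ h2)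
  · intro a ha b hb β hβ
    have h1 := congrFun ((Finset.mem_filter.mp ha).2.trans (Finset.mem_filter.mp hb).2.symm) ⟨β, hβ⟩
    simp only [hcell] at h1
    rw [sub_smul, ← dist_eq_norm]
    have h2 := dist_triangle_right (b • β) (a • β) (κ (b • β))
    have h3 := hκd (a • β)
    rw [h1] at h3
    linarith [hκd (b • β)]

/-! ### Transference to the counting theorem -/

/-- If the functions `g i` have sum at least `1/2` on `U`, colour each `x ∈ U` by some `i` for which
`g i x` is large. -/
theorem exists_colouring_card_mono_le {r s : ℕ} (c : Fin s → ℤ) {g : Fin r → ℤ → ℝ}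
    (hg : ∀ i x, 0 ≤ g i x) {U V : Finset ℤ} (hUV : U ⊆ V) (hU : U.Nonempty)
    (hsum : ∀ x ∈ U, 1 / 2 ≤ ∑ i, g i x) :
    ∃ χ : ℤ → Fin r, (1 / (2 * (r + 1) : ℝ)) ^ s * ((Fintype.piFinset fun _ : Fin s => U).filter
        fun x => ∑ j, c j * x j = 0 ∧ ∃ e, ∀ j, χ (x j) = e).card ≤
      ∑ i, ∑ x ∈ (Fintype.piFinset fun _ => V).filter (fun x : Fin s → ℤ => ∑ j, c j * x j = 0),
        ∏ j, g i (x j) := by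
  classical
  -- With `r + 1` in place of `r` the inequality `r / (2 (r + 1)) < 1 / 2` is strict and holds for
  -- `r = 0` too.
  have hex : ∀ x ∈ U, ∃ i, 1 / (2 * (r + 1) : ℝ) ≤ g i x := by
    intro x hx
    by_contra! hcon
    have h1 : ∑ i, g i x ≤ ∑ _i : Fin r, 1 / (2 * (r + 1) : ℝ) :=
      Finset.sum_le_sum fun i _ => (hcon i).le
    have h2 : ∑ _i : Fin r, 1 / (2 * (r + 1) : ℝ) < 1 / 2 := by
      simp only [Finset.sum_const, Finset.card_univ, Fintype.card_fin, nsmul_eq_mul]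
      rw [mul_one_div, div_lt_div_iff₀ (by positivity) (by positivity)]
      linarith
    linarith [hsum x hx]
  obtain ⟨x₀, hx₀⟩ := hU
  obtain ⟨i₀, -⟩ := hex x₀ hx₀
  have hχ : ∀ x, ∃ i : Fin r, x ∈ U → 1 / (2 * (r + 1) : ℝ) ≤ g i x := fun x => by
    by_cases hx : x ∈ U
    · obtain ⟨i, hi⟩ := hex x hx
      exact ⟨i, fun _ => hi⟩
    · exact ⟨i₀, fun h => absurd h hx⟩
  choose χ hχ using hχ
  refine ⟨χ, ?_⟩
  generalize hS : (Fintype.piFinset fun _ : Fin s => U).filter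
    (fun x => ∑ j, c j * x j = 0 ∧ ∃ e, ∀ j, χ (x j) = e) = S
  have hSV : S ⊆ (Fintype.piFinset fun _ => V).filter
      (fun x : Fin s → ℤ => ∑ j, c j * x j = 0) := by
    intro x hx
    rw [← hS] at hx
    obtain ⟨hxU, hx0, -⟩ := Finset.mem_filter.mp hx
    exact Finset.mem_filter.mpr ⟨Fintype.mem_piFinset.mpr fun j =>
      hUV (Fintype.mem_piFinset.mp hxU j), hx0⟩
  have hnn : ∀ (x : Fin s → ℤ) (i : Fin r), 0 ≤ ∏ j, g i (x j) := fun x i =>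
    Finset.prod_nonneg fun j _ => hg i _
  rw [Finset.sum_comm]
  calc (1 / (2 * (r + 1) : ℝ)) ^ s * S.card = ∑ _x ∈ S, (1 / (2 * (r + 1) : ℝ)) ^ s := by
        rw [Finset.sum_const, nsmul_eq_mul, mul_comm]
    _ ≤ ∑ x ∈ S, ∑ i, ∏ j, g i (x j) := Finset.sum_le_sum fun x hx => ?_
    _ ≤ _ := Finset.sum_le_sum_of_subset_of_nonneg hSV fun x _ _ =>
        Finset.sum_nonneg fun i _ => hnn x i
  rw [← hS] at hx
  obtain ⟨hxU, -, e, he⟩ := Finset.mem_filter.mp hx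
  calc (1 / (2 * (r + 1) : ℝ)) ^ s = ∏ _j : Fin s, 1 / (2 * (r + 1) : ℝ) := by
        rw [Finset.prod_const, Finset.card_univ, Fintype.card_fin]
    _ ≤ ∏ j, g e (x j) := Finset.prod_le_prod (fun _ _ => by positivity) fun j _ => by
        have := hχ (x j) (Fintype.mem_piFinset.mp hxU j)
        rwa [he j] at this
    _ ≤ _ := Finset.single_le_sum (f := fun i => ∏ j, g i (x j)) (fun i _ => hnn x i)
        (Finset.mem_univ e)

theorem averageDiff_nonneg {A : Finset ℤ} {f : ℤ → ℝ} (hf : ∀ x, 0 ≤ f x) (x : ℤ) :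
    0 ≤ averageDiff A f x :=
  div_nonneg (Finset.sum_nonneg fun _ _ => Finset.sum_nonneg fun _ _ => hf _) (by positivity)

theorem averageDiff_sum_sub {ι : Type*} [Fintype ι] (A : Finset ℤ) (f : ι → ℤ → ℝ) (g : ℤ → ℝ)
    (x : ℤ) : averageDiff A (fun y => ∑ i, f i y - g y) x =
      ∑ i, averageDiff A (f i) x - averageDiff A g x := by
  simp only [averageDiff, Finset.sum_sub_distrib, sub_div, ← Finset.sum_div]
  congr 2
  symm
  rw [Finset.sum_comm]
  exact Finset.sum_congr rfl fun a _ => Finset.sum_comm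

theorem averageDiff_eq_one {A : Finset ℤ} (hA : A.Nonempty) {f : ℤ → ℝ} {x : ℤ}
    (h : ∀ a ∈ A, ∀ b ∈ A, f (x + a - b) = 1) : averageDiff A f x = 1 := by
  have hA' : (A.card : ℝ) ≠ 0 := by simpa using hA.ne_empty
  rw [averageDiff, Finset.sum_congr rfl fun a ha => Finset.sum_congr rfl fun b hb => h a ha b hb]
  simp
  field_simp

/-- On the spectrum, which lies near `R`, the weight is close to `1`. -/
theorem norm_mul_one_sub_fejerWeight_le {N n : ℕ} (hN : 0 < N) (hnN : n ≤ N) {A : Finset ℤ}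
    (hA : A.Nonempty) (hAn : A ⊆ Finset.Icc 1 (n : ℤ)) {R : Finset UnitAddCircle} {ε δ : ℝ}
    (hδε : 2 * Real.pi * (δ + δ) ≤ ε)
    (hAR : ∀ a ∈ A, ∀ b ∈ A, ∀ β ∈ R, ‖(b - a) • β‖ ≤ δ) {f : ℤ → ℂ}
    (hf : ∑ x ∈ interval N, ‖f x‖ ≤ N)
    (hR : ∀ α, ε * N < ‖trigSum (interval N) f α‖ → ∃ β ∈ R, ‖α - β‖ ≤ δ / N)
    (α : UnitAddCircle) :
    ‖trigSum (interval N) f α‖ * (1 - fejerWeight A α) ≤ ε * N := by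
  have hN' : (0 : ℝ) < N := by exact_mod_cast hN
  have hw := fejerWeight_nonneg A α
  have hw1 := fejerWeight_le_one A α
  rcases le_or_gt ‖trigSum (interval N) f α‖ (ε * N) with h | h
  · nlinarith [norm_nonneg (trigSum (interval N) f α)]
  · obtain ⟨β, hβ, hαβ⟩ := hR α h
    have h1 : 1 - fejerWeight A α ≤ 2 * Real.pi * (δ + δ) := by
      refine one_sub_fejerWeight_le hA fun a ha b hb => ?_
      have h2 : (b - a) • α = (b - a) • β + (b - a) • (α - β) := by
        rw [← smul_add, add_sub_cancel]
      rw [h2]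
      refine (norm_add_le _ _).trans (add_le_add (hAR a ha b hb β hβ) ?_)
      refine (norm_zsmul_le _ _).trans ?_
      have ha' := Finset.mem_Icc.mp (hAn ha)
      have hb' := Finset.mem_Icc.mp (hAn hb)
      have h3 : ‖b - a‖ ≤ N := by
        rw [Int.norm_eq_abs]
        have : |b - a| ≤ N := abs_le.mpr ⟨by omega, by omega⟩
        exact_mod_cast this
      calc ‖b - a‖ * ‖α - β‖ ≤ N * (δ / N) := mul_le_mul h3 hαβ (norm_nonneg _) hN'.le
        _ = δ := by field_simp
    calc _ ≤ (N : ℝ) * ε := mul_le_mul ((norm_trigSum_le _ _ _).trans hf) (h1.trans hδε)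
          (by linarith) hN'.le
      _ = ε * N := mul_comm _ _

/-- The theorem for weights normalised to have mean value about `1`. -/
theorem exists_sum_solutions_ge {s : ℕ} {c : Fin s → ℤ} (hc : ∀ j, c j ≠ 0)
    (hI : ∃ I : Finset (Fin s), I.Nonempty ∧ ∑ j ∈ I, c j = 0) (r : ℕ) {K δ : ℝ} (hK : 0 ≤ K)
    (hδ : 0 < δ) (hδ1 : δ ≤ 1) :
    ∃ (N₀ M : ℕ) (κ : ℝ), 0 < N₀ ∧ 0 < M ∧ 0 < κ ∧ ∀ N : ℕ, N₀ ≤ N → ∀ F : Fin r → ℤ → ℝ,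
      (∀ i x, 0 ≤ F i x) → (∀ i, ∀ x ∉ interval N, F i x = 0) →
      (∀ i, ∑ x ∈ interval N, F i x ≤ N) →
      (∀ i, ∫ α, ‖trigSum (interval N) (fun x => (F i x : ℂ)) α‖ ^ ((s : ℝ) - δ) ≤
        K * (N : ℝ) ^ ((s : ℝ) - δ) * (N : ℝ)⁻¹) →
      (∀ α, ‖trigSum (interval N)
        (fun x => ((∑ i, F i x - intervalIndicator N x : ℝ) : ℂ)) α‖ ≤ N / M) →
      κ * (N : ℝ) ^ s * (N : ℝ)⁻¹ ≤ ∑ i, ∑ x ∈ solutions c N, ∏ j, F i (x j) := by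
  classical
  obtain ⟨I, hne, hI⟩ := hI
  have hs : 1 ≤ s := by
    obtain ⟨j, -⟩ := hne
    exact j.pos
  obtain ⟨Q, C, hQ, hQC⟩ := card_mono_solutions_ge hc hne hI r
  set q : ℝ := 2 * (Q + 1) with hq
  have hq0 : 0 < q := by positivity
  set κ : ℝ := (1 / (2 * (r + 1) : ℝ)) ^ s / ((C + 1) * q ^ s) with hκ
  have hκ0 : 0 < κ := by positivity
  -- Chosen so that the `r` errors `s ^ 2 * K * E` total at most `κ / 2`; then `ε` is chosen with `ε
  -- ^ δ = E`.
  set E : ℝ := κ / (2 * (r * (s ^ 2 * K) + 1)) with hE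
  have hE0 : 0 < E := by positivity
  set ε : ℝ := E ^ δ⁻¹ with hε
  have hε0 : 0 < ε := by positivity
  have hεδ : ε ^ δ = E := by
    rw [hε, ← Real.rpow_mul hE0.le, inv_mul_cancel₀ hδ.ne', Real.rpow_one]
  set δ' : ℝ := min 1 (ε / (4 * Real.pi)) with hδ'
  have hδ'0 : 0 < δ' := lt_min one_pos (by positivity)
  have hδ'ε : 2 * Real.pi * (δ' + δ') ≤ ε := by
    have h1 : δ' * (4 * Real.pi) ≤ ε := by
      rw [← le_div_iff₀ (by positivity)]
      exact min_le_right _ _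
    linarith
  have hp : 0 ≤ (s : ℝ) - δ := by
    have : (1 : ℝ) ≤ s := by exact_mod_cast hs
    linarith
  obtain ⟨B, hB⟩ := exists_spectrum_net (p := (s : ℝ) - δ) (K := K) hp hε0 hδ'0
    (min_le_left _ _) (by nlinarith [Real.pi_pos])
  obtain ⟨m, hm, hbohr⟩ := exists_dense_bohr_differences (r * B) hδ'0
  -- Since `N ≤ 2 (Q + 1) n ≤ 2 (Q + 1) m * A.card`, this `M` gives `N / M / A.card ≤ 1 / 2`.
  refine ⟨Q + 1, 4 * (Q + 1) * m, κ / 2, Nat.succ_pos Q, by positivity, by positivity,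
    fun N hN F hF hsupp hl1 hrest hdecay => ?_⟩
  have hN0 : 0 < N := by omega
  have hN' : (0 : ℝ) < N := by exact_mod_cast hN0
  -- With this `n`, translates of `[n, Qn]` by `A - A` stay inside `[N]`, where the indicator equals
  -- 1.
  set n : ℕ := N / (Q + 1) with hn
  have hn0 : 0 < n := Nat.div_pos hN (Nat.succ_pos Q)
  have hQn : Q * n + n ≤ N := by
    have := Nat.mul_div_le N (Q + 1)
    rw [← hn] at this
    linarith
  have hNn : (N : ℝ) ≤ q * n := by
    have h1 : N < (Q + 1) * (n + 1) := Nat.lt_mul_div_succ N (Nat.succ_pos Q)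
    have h2 : N ≤ 2 * (Q + 1) * n := by nlinarith
    rw [hq]
    exact_mod_cast h2
  have hl1' : ∀ i, ∑ x ∈ interval N, ‖(F i x : ℂ)‖ ≤ N := fun i => by
    refine le_trans (le_of_eq (Finset.sum_congr rfl fun x _ => ?_)) (hl1 i)
    rw [Complex.norm_real, Real.norm_of_nonneg (hF i x)]
  have hnet : ∀ i, ∃ R : Finset UnitAddCircle, R.card ≤ B ∧
      ∀ α, ε * N < ‖trigSum (interval N) (fun x => (F i x : ℂ)) α‖ → ∃ β ∈ R, ‖α - β‖ ≤ δ' / N :=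
    fun i => hB N hN0 _ (hl1' i) (hrest i)
  choose R hRB hR using hnet
  -- A single `A` serves all colours: the union of the `r` nets has at most `r * B` points.
  obtain ⟨A, hAn, hAcard, hAR⟩ := hbohr n (Finset.univ.biUnion R) (by
    refine Finset.card_biUnion_le.trans ((Finset.sum_le_sum fun i _ => hRB i).trans ?_)
    simp)
  have hA : A.Nonempty := by
    rw [← Finset.card_pos]
    by_contra h
    rw [Nat.eq_zero_of_not_pos h, mul_zero] at hAcard
    omega
  have hAmem : ∀ a ∈ A, 1 ≤ a ∧ a ≤ n := fun a ha => Finset.mem_Icc.mp (hAn ha)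
  have hnN : n ≤ N := by nlinarith
  set V : Finset ℤ := Finset.Icc (-(N : ℤ)) (2 * N) with hV
  have hVmem : ∀ x ∈ interval N, ∀ a ∈ A, ∀ b ∈ A, x - a + b ∈ V := by
    intro x hx a ha b hb
    have h1 := Finset.mem_Icc.mp hx
    have h2 := hAmem a ha
    have h3 := hAmem b hb
    rw [hV, Finset.mem_Icc]
    omega
  set U : Finset ℤ := Finset.Icc (n : ℤ) (Q * n) with hU
  have hUV : U ⊆ V := by
    intro x hx
    rw [hU, Finset.mem_Icc] at hx
    rw [hV, Finset.mem_Icc]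
    have : (Q * n + n : ℤ) ≤ N := by exact_mod_cast hQn
    omega
  have hUne : U.Nonempty := by
    rw [hU, Finset.nonempty_Icc]
    exact_mod_cast Nat.le_mul_of_pos_left n hQ
  have hAcard' : 0 < (A.card : ℝ) := by exact_mod_cast hA.card_pos
  have hlarge : ∀ x ∈ U, 1 / 2 ≤ ∑ i, averageDiff A (F i) x := by
    intro x hx
    have h1 := abs_averageDiff_le hA (W := interval N) (V := V)
      (f := fun x => ∑ i, F i x - intervalIndicator N x) (fun x hx => ?_) hVmem hdecay (hUV hx)
    · rw [averageDiff_sum_sub, averageDiff_eq_one hA (f := intervalIndicator N)] at h1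
      · have h2 : (N : ℝ) / (4 * (Q + 1) * m : ℕ) / A.card ≤ 1 / 2 := by
          have h3 : (n : ℝ) ≤ m * A.card := by exact_mod_cast hAcard
          have hm' : (0 : ℝ) < m := by exact_mod_cast hm
          rw [div_div, div_le_div_iff₀ (by positivity) (by positivity)]
          push_cast
          calc (N : ℝ) * 2 ≤ q * n * 2 := by linarith
            _ ≤ q * (m * A.card) * 2 := by gcongr
            _ = _ := by rw [hq]; ring
        linarith [(abs_le.mp h1).1]
      · intro a ha b hb
        have h2 := hAmem a ha
        have h3 := hAmem b hb
        rw [hU, Finset.mem_Icc] at hx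
        have : (Q * n + n : ℤ) ≤ N := by exact_mod_cast hQn
        have hmem : x + a - b ∈ interval N := Finset.mem_Icc.mpr ⟨by omega, by omega⟩
        exact Set.indicator_of_mem (by exact_mod_cast hmem) _
    · have : intervalIndicator N x = 0 := Set.indicator_of_notMem (by exact_mod_cast hx) _
      simp [this, hsupp _ x hx]
  obtain ⟨χ, hχ⟩ := exists_colouring_card_mono_le c
    (fun i => averageDiff_nonneg (A := A) (hF i)) hUV hUne hlarge
  have hcount := hQC n hn0 χ
  set mono : ℕ := ((Fintype.piFinset fun _ : Fin s => U).filter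
    fun x => ∑ j, c j * x j = 0 ∧ ∃ e, ∀ j, χ (x j) = e).card with hmono
  have hmain : κ * (N : ℝ) ^ s * (N : ℝ)⁻¹ ≤ (1 / (2 * (r + 1) : ℝ)) ^ s * mono := by
    have h1 : (N : ℝ) ^ s ≤ q ^ s * ((C + 1) * (N * mono)) := by
      calc (N : ℝ) ^ s ≤ (q * n) ^ s := pow_le_pow_left₀ hN'.le hNn s
        _ = q ^ s * (n : ℝ) ^ s := mul_pow _ _ _
        _ ≤ q ^ s * (C * (n * mono)) := by
            gcongr
            exact_mod_cast hcount
        _ ≤ _ := by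
            gcongr
            linarith
    rw [hκ, div_mul_eq_mul_div, div_mul_eq_mul_div, div_le_iff₀ (by positivity),
      mul_assoc, mul_assoc]
    refine mul_le_mul_of_nonneg_left ?_ (by positivity)
    rw [← div_eq_mul_inv, div_le_iff₀ hN']
    linarith
  have herr : ∀ i, ∑ x ∈ (Fintype.piFinset fun _ => V).filter
        (fun x : Fin s → ℤ => ∑ j, c j * x j = 0), ∏ j, averageDiff A (F i) (x j) -
      s ^ 2 * K * E * ((N : ℝ) ^ s * (N : ℝ)⁻¹) ≤ ∑ x ∈ solutions c N, ∏ j, F i (x j) := by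
    intro i
    have h1 := abs_sum_solutions_sub_le hc (hsupp i) hVmem hδ hδ1
      (norm_mul_one_sub_fejerWeight_le hN0 hnN hA hAn hδ'ε
        (fun a ha b hb β hβ => hAR a ha b hb β
          (Finset.mem_biUnion.mpr ⟨i, Finset.mem_univ i, hβ⟩)) (hl1' i) (hR i))
    have h2 : s ^ 2 * (ε * N) ^ δ *
        ∫ α, ‖trigSum (interval N) (fun x => (F i x : ℂ)) α‖ ^ ((s : ℝ) - δ) ≤
        s ^ 2 * K * E * ((N : ℝ) ^ s * (N : ℝ)⁻¹) := by
      calc _ ≤ s ^ 2 * (ε * N) ^ δ * (K * (N : ℝ) ^ ((s : ℝ) - δ) * (N : ℝ)⁻¹) := by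
            gcongr
            exact hrest i
        _ = s ^ 2 * K * E * ((N : ℝ) ^ δ * (N : ℝ) ^ ((s : ℝ) - δ) * (N : ℝ)⁻¹) := by
            rw [Real.mul_rpow hε0.le hN'.le, hεδ]
            ring
        _ = _ := by rw [← Real.rpow_add hN', add_sub_cancel, Real.rpow_natCast]
    have h3 := (abs_le.mp (h1.trans h2)).1
    have h4 : solutions c N = (Fintype.piFinset fun _ => interval N).filter
      (fun x : Fin s → ℤ => ∑ j, c j * x j = 0) := rfl
    rw [h4]
    linarith
  have hsum := Finset.sum_le_sum fun i (_ : i ∈ Finset.univ) => herr i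
  rw [Finset.sum_sub_distrib] at hsum
  refine le_trans ?_ hsum
  have hNs : 0 ≤ (N : ℝ) ^ s * (N : ℝ)⁻¹ := by positivity
  have hsmall : (r : ℝ) * (s ^ 2 * K * E) ≤ κ / 2 := by
    rw [hE, mul_div_assoc', mul_div_assoc', div_le_div_iff₀ (by positivity) (by positivity)]
    nlinarith
  simp only [Finset.sum_const, Finset.card_univ, Fintype.card_fin, nsmul_eq_mul]
  have h5 := mul_le_mul_of_nonneg_right hsmall hNs
  linarith [hmain.trans hχ]

end PseudorandomRado

/-! ### Normalisation of the weight -/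

theorem mainTheorem12 (s : ℕ) (c : Fin s → ℤ) (hc : ∀ j, c j ≠ 0)
    (hI : ∃ I : Finset (Fin s), I.Nonempty ∧ ∑ j ∈ I, c j = 0) (r K : ℕ) :
    ∃ (N₀ M : ℕ) (c₀ : ℝ), 0 < M ∧ 0 < c₀ ∧
      ∀ N : ℕ, N₀ ≤ N →
        ∀ ν : ℤ → ℝ, (∀ x ∈ PseudorandomRado.interval N, 0 ≤ ν x) →
          PseudorandomRado.SatisfiesRestriction N ν ((s : ℝ) - 0.005) (K : ℝ) →
          PseudorandomRado.HasFourierDecay N ν (1 / (M : ℝ)) →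
          ∀ f : Fin r → ℤ → ℝ,
            (∀ i, ∀ x ∈ PseudorandomRado.interval N, 0 ≤ f i x) →
            (∀ x ∈ PseudorandomRado.interval N, ν x = ∑ i, f i x) →
            c₀ * PseudorandomRado.l1Norm N ν ^ s * (N : ℝ)⁻¹ ≤
              ∑ i, ∑ x ∈ PseudorandomRado.solutions c N, ∏ j, f i (x j) := by
  open PseudorandomRado in
  classical
  obtain ⟨N₀, M, κ, hN₀, hM, hκ, hmain⟩ := exists_sum_solutions_ge hc hI r (K := K) (δ := 0.005)
    (Nat.cast_nonneg K) (by norm_num) (by norm_num)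
  refine ⟨N₀, M, κ, hM, hκ, fun N hN ν hν hrest hdecay f hf hνf => ?_⟩
  have hN' : (0 : ℝ) < N := by exact_mod_cast hN₀.trans_le hN
  have hs : s ≠ 0 := by
    obtain ⟨I, ⟨j, -⟩, -⟩ := hI
    exact j.pos.ne'
  have hsol : ∀ x ∈ solutions c N, ∀ j, x j ∈ interval N := fun x hx =>
    Fintype.mem_piFinset.mp (Finset.mem_filter.mp hx).1
  set X : ℝ := l1Norm N ν with hX
  have hX0 : 0 ≤ X := Finset.sum_nonneg fun _ _ => abs_nonneg _
  -- If `ν` vanishes on `[N]`, the lower bound is zero because `s ≥ 1`.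
  rcases hX0.eq_or_lt with h0 | hXpos
  · rw [← h0, zero_pow hs, mul_zero, zero_mul]
    exact Finset.sum_nonneg fun i _ => Finset.sum_nonneg fun x hx =>
      Finset.prod_nonneg fun j _ => hf i _ (hsol x hx j)
  have hXsum : X = ∑ x ∈ interval N, ν x :=
    Finset.sum_congr rfl fun x hx => abs_of_nonneg (hν x hx)
  have hfν : ∀ i, ∀ x ∈ interval N, f i x ≤ ν x := fun i x hx => by
    rw [hνf x hx]
    exact Finset.single_le_sum (f := fun i => f i x) (fun i _ => hf i x hx) (Finset.mem_univ i)
  have hNX : 0 < (N : ℝ) / X := by positivity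
  -- Scaling by `N / X` gives total mass `N`; the restriction estimate is homogeneous, and Fourier
  -- decay is merely multiplied by `N`. Extension by zero supplies the support condition.
  set F : Fin r → ℤ → ℝ := fun i x => if x ∈ interval N then N / X * f i x else 0 with hFdef
  have hFin : ∀ i, ∀ x ∈ interval N, F i x = N / X * f i x := fun i x hx => if_pos hx
  have hFtrig : ∀ i α, trigSum (interval N) (fun x => (F i x : ℂ)) α =
      ((N / X : ℝ) : ℂ) * fourierTransform N (fun x => (f i x : ℂ)) α := by
    intro i α
    rw [trigSum, fourierTransform, Finset.mul_sum]
    refine Finset.sum_congr rfl fun x hx => ?_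
    rw [hFin i x hx, Complex.ofReal_mul, mul_assoc]
  have key := hmain N hN F (fun i x => ?_) (fun i x hx => if_neg hx) (fun i => ?_) (fun i => ?_)
    fun α => ?_
  · have h1 : ∀ i, ∑ x ∈ solutions c N, ∏ j, F i (x j) =
        (N / X) ^ s * ∑ x ∈ solutions c N, ∏ j, f i (x j) := by
      intro i
      rw [Finset.mul_sum]
      refine Finset.sum_congr rfl fun x hx => ?_
      rw [Finset.prod_congr rfl fun j _ => hFin i _ (hsol x hx j), Finset.prod_mul_distrib,
        Finset.prod_const, Finset.card_univ, Fintype.card_fin]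
    simp only [h1, ← Finset.mul_sum] at key
    refine le_of_mul_le_mul_left ?_ (pow_pos hNX s)
    refine le_trans (le_of_eq ?_) key
    rw [div_pow]
    field_simp
  · simp only [hFdef]
    split_ifs with hx
    · exact mul_nonneg hNX.le (hf i x hx)
    · exact le_rfl
  · rw [Finset.sum_congr rfl (hFin i), ← Finset.mul_sum]
    calc N / X * ∑ x ∈ interval N, f i x ≤ N / X * X := by
          rw [hXsum]
          exact mul_le_mul_of_nonneg_left (Finset.sum_le_sum (hfν i)) (by rw [← hXsum]; exact hNX.le)
      _ = N := by field_simp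
  · have h1 := hrest (fun x => (f i x : ℂ)) fun x hx => by
      rw [Complex.norm_real, Real.norm_of_nonneg (hf i x hx)]
      exact hfν i x hx
    have h2 : ∀ α, ‖trigSum (interval N) (fun x => (F i x : ℂ)) α‖ ^ ((s : ℝ) - 0.005) =
        (N / X) ^ ((s : ℝ) - 0.005) *
          ‖fourierTransform N (fun x => (f i x : ℂ)) α‖ ^ ((s : ℝ) - 0.005) := fun α => by
      rw [hFtrig, norm_mul, Complex.norm_real, Real.norm_of_nonneg hNX.le,
        Real.mul_rpow hNX.le (norm_nonneg _)]
    simp only [h2]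
    rw [integral_const_mul]
    calc _ ≤ (N / X) ^ ((s : ℝ) - 0.005) * (K * X ^ ((s : ℝ) - 0.005) * (N : ℝ)⁻¹) :=
          mul_le_mul_of_nonneg_left h1 (by positivity)
      _ = K * (N / X * X) ^ ((s : ℝ) - 0.005) * (N : ℝ)⁻¹ := by
          rw [Real.mul_rpow hNX.le hX0]
          ring
      _ = _ := by rw [div_mul_cancel₀ _ hXpos.ne']
  · have hl1 : l1Norm N (intervalIndicator N) = N := by
      have h1 : ∀ x ∈ interval N, |intervalIndicator N x| = 1 := fun x hx => by
        rw [intervalIndicator, Set.indicator_of_mem (by exact_mod_cast hx), abs_one]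
      rw [l1Norm, Finset.sum_congr rfl h1]
      simp [interval]
    have hXC : (X : ℂ) ≠ 0 := by exact_mod_cast hXpos.ne'
    have hNC : (N : ℂ) ≠ 0 := by exact_mod_cast hN'.ne'
    have h1 := hdecay α
    rw [hl1, ← hX] at h1
    have h2 : trigSum (interval N) (fun x => ((∑ i, F i x - intervalIndicator N x : ℝ) : ℂ)) α =
        N * (fourierTransform N (fun x => (ν x : ℂ)) α / (X : ℂ) -
          fourierTransform N (fun x => (intervalIndicator N x : ℂ)) α / ((N : ℝ) : ℂ)) := by
      have h3 : ∀ x ∈ interval N, ∑ i, F i x = N / X * ν x := fun x hx => by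
        rw [Finset.sum_congr rfl fun i _ => hFin i x hx, ← Finset.mul_sum, hνf x hx]
      rw [mul_sub, Complex.ofReal_natCast, mul_div_cancel₀ _ hNC, mul_div_assoc', mul_div_right_comm]
      simp only [trigSum, fourierTransform, Finset.mul_sum]
      rw [← Finset.sum_sub_distrib]
      refine Finset.sum_congr rfl fun x hx => ?_
      rw [h3 x hx]
      push_cast
      ring
    rw [h2, norm_mul, Complex.norm_natCast, div_eq_mul_one_div (N : ℝ)]
    exact mul_le_mul_of_nonneg_left h1 hN'.le
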